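/- Let $\mathcal M$ be a smooth four-dimensional manifold with a smooth pseudo-Riemannian metric $\mathbf g$ and two commuting Killing fields $\xi_1,\xi_2$ such that $h_{kl}=\mathbf g(\xi_k,\xi_l)$ satisfies $x:=\det h\neq 0$ everywhere and the distribution $\Xi^\perp$ orthogonal to $\Xi=\langle\xi_1,\xi_2\rangle$ is integrable (orthogonal transitivity). Let $\mathcal S$ be an integral surface of $\Xi^\perp$ with local coordinates $t^1,t^2$, let $g_{ij}$ be the metric induced on $\mathcal S$, with scalar curvature $R$, and regard $h_{kl}$ as functions on $\mathcal S$. Put $$\chi=\frac{dh_{11}\,dh_{22}-dh_{12}\,dh_{12}}{x},\qquad \gamma=\chi-\tfrac14\Big(\frac{dx}{x}\Big)^2,\qquad C_\chi=g^{ij}\chi_{ij},\qquad Q_\gamma=\frac{\det\gamma}{\det g}.$$ If $\mathbf g$ is a Lorentz metric (of signature $(-+++)$ or $(+---)$), let $(k,l,m,\bar m)$ be a complex null tetrad ($k,l$ real null, $m$ complex null, $k\cdot m=l\cdot m=0$, $k\cdot l=-1$, $m\cdot\bar m=1$ for signature $(-+++)$; the last two signs are reversed for $(+---)$) at a point of $\mathcal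 S$, adapted to $T\mathcal M=\Xi\oplus\Xi^\perp$ in the sense that $k,l$ lie in one of the two planes and $m$ in the complexification of the other. Let $\Psi_2=\mathbf C_{abcd}k^am^b\bar m^cl^d$, where $\mathbf C$ is the Weyl tensor of $\mathbf g$ (curvature sign: positive sectional curvature on round spheres). 1. If $\mathbf g$ satisfies the vacuum equations with cosmological constant, $\mathbf{Ric}-\frac12\mathbf R\,\mathbf g+\Lambda\mathbf g=0$, then $R=-\frac12C_\chi$, and if moreover $\mathbf g$ is Lorentz, then for every adapted null tetrad $$\operatorname{Re}\Psi_2=\tfrac18C_\chi+\tfrac16\Lambda .$$ 2. For every Lorentz $\mathbf g$ as above (vacuum or not), $Q_\gamma\le 0$, $|\operatorname{Im}\Psi_2|=\frac14\sqrt{-Q_\gamma}$ for every adapted null tetrad, and there is an adapted null tetrad with $\operatorname{Im}\Psi_2=\frac14\sqrt{-Q_\gamma}$ (interchanging $m$ and $\bar m$ changes the sign of $\operatorname{Im}\Psi_2$). 3. The functions $\frac18C_\chi+\frac16\Lambda$ (for every $\Lambda\in\mathbb R$) and $\frac14\sqrt{-Q_\gamma}$ of the 1-jet of $(g,h)$ are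 scalar differential invariants of the first order: they do not change under local diffeomorphisms of $\mathcal S$ acting by pull-back on $(g,h)$ and under constant changes of basis $h\mapsto a^{T}ha$, $a\in GL_2(\mathbb R)$. Hence, for vacuum Lorentz metrics with cosmological constant $\Lambda$, $\operatorname{Re}\Psi_2$ is a first-order invariant. -/

import Mathlib

open scoped Manifold ContDiff Matrix ComplexConjugate

noncomputable section

namespace TwoKilling

/-- The coordinate space `ℝⁿ`. -/
abbrev Coord (n : ℕ) := EuclideanSpace ℝ (Fin n)

/-- The coordinate vector `∂/∂yᵃ`. -/
def coordVec {n : ℕ} (a : Fin n) : Coord n := EuclideanSpace.single a 1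

/-- The partial derivative `∂f/∂yᵃ`. -/
def pd {n : ℕ} (a : Fin n) (f : Coord n → ℝ) (y : Coord n) : ℝ := fderiv ℝ f y (coordVec a)

/-! ### Curvature of a metric given by its coordinate components -/

/-- Christoffel symbols `Γᶜₐᵦ` of the metric with components `G`. -/
def christoffel {n : ℕ} (G : Coord n → Matrix (Fin n) (Fin n) ℝ) (c a b : Fin n)
    (y : Coord n) : ℝ :=
  (1 / 2) * ∑ d, (G y)⁻¹ c d *
    (pd a (fun z => G z b d) y + pd b (fun z => G z a d) y - pd d (fun z => G z a b) y)

/-- `Rᵃ_{bcd} = ∂_c Γᵃ_{db} - ∂_d Γᵃ_{cb} + Γᵃ_{ce} Γᵉ_{db} - Γᵃ_{de} Γᵉ_{cb}`. -/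
def riemannUp {n : ℕ} (G : Coord n → Matrix (Fin n) (Fin n) ℝ) (y : Coord n)
    (a b c d : Fin n) : ℝ :=
  pd c (christoffel G a d b) y - pd d (christoffel G a c b) y
    + ∑ e, (christoffel G a c e y * christoffel G e d b y
      - christoffel G a d e y * christoffel G e c b y)

/-- `R_{abcd}`; for a surface `R_{1212} = K det G` with `K` the Gauss curvature. -/
def riemann {n : ℕ} (G : Coord n → Matrix (Fin n) (Fin n) ℝ) (y : Coord n)
    (a b c d : Fin n) : ℝ :=
  ∑ e, G y a e * riemannUp G y e b c d

/-- Ricci tensor `R_{bd} = Rᵃ_{bad}`. -/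
def ricci {n : ℕ} (G : Coord n → Matrix (Fin n) (Fin n) ℝ) (y : Coord n) (b d : Fin n) : ℝ :=
  ∑ a, riemannUp G y a b a d

/-- Scalar curvature. -/
def scalarCurv {n : ℕ} (G : Coord n → Matrix (Fin n) (Fin n) ℝ) (y : Coord n) : ℝ :=
  ∑ b, ∑ d, (G y)⁻¹ b d * ricci G y b d

/-- The Weyl tensor in dimension four,
`C_{abcd} = R_{abcd} - g_{a[c} R_{d]b} + g_{b[c} R_{d]a} + (R/3) g_{a[c} g_{d]b}`. -/
def weyl (G : Coord 4 → Matrix (Fin 4) (Fin 4) ℝ) (y : Coord 4) (a b c d : Fin 4) : ℝ :=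
  riemann G y a b c d
    - (1 / 2) * (G y a c * ricci G y d b - G y a d * ricci G y c b)
    + (1 / 2) * (G y b c * ricci G y d a - G y b d * ricci G y c a)
    + scalarCurv G y / 3 * ((1 / 2) * (G y a c * G y d b - G y a d * G y c b))

/-- Value of a bilinear form on two real vectors. -/
def ip {n : ℕ} (A : Matrix (Fin n) (Fin n) ℝ) (u v : Coord n) : ℝ :=
  ∑ a, ∑ b, A a b * u a * v b

/-! ### Killing pairs in coordinates -/

/-- The Killing equation `(L_η G)ₐᵦ = 0` at `y`. -/
def KillingAt (G : Coord 4 → Matrix (Fin 4) (Fin 4) ℝ) (η : Coord 4 → Coord 4)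
    (y : Coord 4) : Prop :=
  ∀ a b, ∑ c, (η y c * pd c (fun z => G z a b) y
    + G y c b * pd a (fun z => η z c) y + G y a c * pd b (fun z => η z c) y) = 0

/-- `h_{kl} = G(ξ_k, ξ_l)`. -/
def killingGram (G : Coord 4 → Matrix (Fin 4) (Fin 4) ℝ) (ξ : Fin 2 → Coord 4 → Coord 4)
    (y : Coord 4) : Matrix (Fin 2) (Fin 2) ℝ :=
  Matrix.of fun k l => ip (G y) (ξ k y) (ξ l y)

/-- `σ`, on the open set `V ⊆ ℝ²`, parametrizes a piece in `U` of an integral surface of the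
distribution orthogonal to `ξ₁, ξ₂`. -/
structure IsLeaf (G : Coord 4 → Matrix (Fin 4) (Fin 4) ℝ) (ξ : Fin 2 → Coord 4 → Coord 4)
    (U : Set (Coord 4)) (V : Set (Coord 2)) (σ : Coord 2 → Coord 4) : Prop where
  isOpen : IsOpen V
  smooth : ContDiffOn ℝ ∞ σ V
  mapsTo : Set.MapsTo σ V U
  immersion : ∀ t ∈ V, Function.Injective (fderiv ℝ σ t)
  orthogonal : ∀ t ∈ V, ∀ (k : Fin 2) (v : Coord 2),
    ip (G (σ t)) (ξ k (σ t)) (fderiv ℝ σ t v) = 0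

/-- On the open set `U`: `G` is a smooth pseudo-Riemannian metric and `ξ₁, ξ₂` are commuting
Killing fields which span, at each point, a plane transversal to its orthogonal complement
(`det h ≠ 0`), and the distribution of orthogonal complements is integrable. -/
structure IsTransitivePairOn (G : Coord 4 → Matrix (Fin 4) (Fin 4) ℝ)
    (ξ : Fin 2 → Coord 4 → Coord 4) (U : Set (Coord 4)) : Prop where
  metric_smooth : ∀ a b, ContDiffOn ℝ ∞ (fun y => G y a b) U
  metric_symm : ∀ y ∈ U, (G y).IsSymm
  metric_nondeg : ∀ y ∈ U, (G y).det ≠ 0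
  field_smooth : ∀ k, ContDiffOn ℝ ∞ (ξ k) U
  killing : ∀ k, ∀ y ∈ U, KillingAt G (ξ k) y
  commute : ∀ y ∈ U, VectorField.lieBracket ℝ (ξ 0) (ξ 1) y = 0
  transversal : ∀ y ∈ U, (killingGram G ξ y).det ≠ 0
  integrable : ∀ y ∈ U, ∃ (V : Set (Coord 2)) (σ : Coord 2 → Coord 4) (t : Coord 2),
    IsLeaf G ξ U V σ ∧ t ∈ V ∧ σ t = y

/-- The metric induced on a leaf, in the coordinates given by the parametrization `σ`. -/
def leafMetric (G : Coord 4 → Matrix (Fin 4) (Fin 4) ℝ) (σ : Coord 2 → Coord 4)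
    (t : Coord 2) : Matrix (Fin 2) (Fin 2) ℝ :=
  Matrix.of fun i j =>
    ip (G (σ t)) (fderiv ℝ σ t (coordVec i)) (fderiv ℝ σ t (coordVec j))

/-- The functions `h_{kl}` on a leaf. -/
def leafGram (G : Coord 4 → Matrix (Fin 4) (Fin 4) ℝ) (ξ : Fin 2 → Coord 4 → Coord 4)
    (σ : Coord 2 → Coord 4) (t : Coord 2) : Matrix (Fin 2) (Fin 2) ℝ :=
  killingGram G ξ (σ t)

/-! ### First-order jets of pairs `(g, h)` and their invariants -/

/-- Values of `g`, `h` and of their first partial derivatives at a point of the surface. -/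
structure OneJet where
  g : Matrix (Fin 2) (Fin 2) ℝ
  h : Matrix (Fin 2) (Fin 2) ℝ
  dg : Fin 2 → Matrix (Fin 2) (Fin 2) ℝ
  dh : Fin 2 → Matrix (Fin 2) (Fin 2) ℝ

/-- The 1-jet at `t` of the pair `(g, h)`. -/
def jet (g h : Coord 2 → Matrix (Fin 2) (Fin 2) ℝ) (t : Coord 2) : OneJet where
  g := g t
  h := h t
  dg := fun i => Matrix.of fun k l => pd i (fun s => g s k l) t
  dh := fun i => Matrix.of fun k l => pd i (fun s => h s k l) t

namespace OneJet

/-- `x = det h`. -/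
def x (j : OneJet) : ℝ := j.h.det

/-- `x_{,i}`, the derivative of `det h`. -/
def dx (j : OneJet) (i : Fin 2) : ℝ :=
  j.dh i 0 0 * j.h 1 1 + j.h 0 0 * j.dh i 1 1 - j.dh i 0 1 * j.h 1 0 - j.h 0 1 * j.dh i 1 0

/-- `ρ = (dx / x)²`. -/
def rho (j : OneJet) : Matrix (Fin 2) (Fin 2) ℝ :=
  Matrix.of fun i k => j.dx i * j.dx k / j.x ^ 2

/-- `χ = (dh₁₁ dh₂₂ - dh₁₂ dh₁₂) / x`. -/
def chi (j : OneJet) : Matrix (Fin 2) (Fin 2) ℝ :=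
  Matrix.of fun i k => 1 / (2 * j.x) *
    ((j.dh i 0 0 * j.dh k 1 1 - j.dh k 0 1 * j.dh i 1 0)
      + (j.dh k 0 0 * j.dh i 1 1 - j.dh i 0 1 * j.dh k 1 0))

/-- The Cosgrove form `γ = χ - ρ / 4`. -/
def gamma (j : OneJet) : Matrix (Fin 2) (Fin 2) ℝ := j.chi - (1 / 4 : ℝ) • j.rho

/-- `C_χ`, the trace of `χ` with respect to `g`. -/
def Cchi (j : OneJet) : ℝ := ∑ i, ∑ k, j.g⁻¹ i k * j.chi i k

/-- `Q_γ = det γ / det g`. -/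
def Qgamma (j : OneJet) : ℝ := j.gamma.det / j.g.det

end OneJet

/-- Pull-back of `g` by the map `φ`. -/
def pullback (φ : Coord 2 → Coord 2) (g : Coord 2 → Matrix (Fin 2) (Fin 2) ℝ) (t : Coord 2) :
    Matrix (Fin 2) (Fin 2) ℝ :=
  Matrix.of fun i j => ip (g (φ t)) (fderiv ℝ φ t (coordVec i)) (fderiv ℝ φ t (coordVec j))

/-- `F`, a function of 1-jets of pairs `(g, h)`, is a first-order scalar differential invariant:
its value does not change under local diffeomorphisms `φ` of the surface, acting by pull-back,
and constant changes `a` of the basis of the Killing algebra, acting by `h ↦ aᵀ h a`. -/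
def IsFirstOrderInvariant (F : OneJet → ℝ) : Prop :=
  ∀ (W V : Set (Coord 2)) (g h : Coord 2 → Matrix (Fin 2) (Fin 2) ℝ) (φ : Coord 2 → Coord 2)
    (a : GL (Fin 2) ℝ),
    IsOpen W → IsOpen V →
    (∀ i j, ContDiffOn ℝ ∞ (fun t => g t i j) W) →
    (∀ i j, ContDiffOn ℝ ∞ (fun t => h t i j) W) →
    (∀ t ∈ W, (g t).IsSymm ∧ (h t).IsSymm ∧ (g t).det ≠ 0 ∧ (h t).det ≠ 0) →
    ContDiffOn ℝ ∞ φ V → Set.MapsTo φ V W →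
    (∀ t ∈ V, Function.Bijective (fderiv ℝ φ t)) →
    ∀ t ∈ V,
      F (jet (pullback φ g)
        (fun s => (a : Matrix (Fin 2) (Fin 2) ℝ)ᵀ * h (φ s) * (a : Matrix (Fin 2) (Fin 2) ℝ)) t)
      = F (jet g h (φ t))

/-! ### Null tetrads and `Ψ₂` -/

/-- Complex-bilinear extension of a real bilinear form. -/
def ipC (A : Matrix (Fin 4) (Fin 4) ℝ) (u v : Fin 4 → ℂ) : ℂ :=
  ∑ a, ∑ b, (A a b : ℂ) * u a * v b

/-- A real vector regarded as a complex one. -/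
def toC (u : Coord 4) : Fin 4 → ℂ := fun a => (u a : ℂ)

/-- Real part of a complex vector. -/
def reV (m : Fin 4 → ℂ) : Coord 4 := WithLp.toLp 2 fun a => (m a).re

/-- Imaginary part of a complex vector. -/
def imV (m : Fin 4 → ℂ) : Coord 4 := WithLp.toLp 2 fun a => (m a).im

/-- Complex null tetrad `(k, l, m, m̄)`: `k, l` real, `k·l = -1`, `m·m̄ = 1` for the signature
`(-+++)` and `k·l = 1`, `m·m̄ = -1` for the signature `(+---)`, all other products zero. -/
structure IsNullTetrad (A : Matrix (Fin 4) (Fin 4) ℝ) (k l : Coord 4) (m : Fin 4 → ℂ) :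
    Prop where
  kk : ip A k k = 0
  ll : ip A l l = 0
  mm : ipC A m m = 0
  km : ipC A (toC k) m = 0
  lm : ipC A (toC l) m = 0
  normalized : (ip A k l = -1 ∧ ipC A m (fun a => conj (m a)) = 1) ∨
    (ip A k l = 1 ∧ ipC A m (fun a => conj (m a)) = -1)

/-- The plane `Ξ` spanned by the Killing vectors. -/
def killingPlane (ξ : Fin 2 → Coord 4 → Coord 4) (y : Coord 4) : Set (Coord 4) :=
  (Submodule.span ℝ (Set.range fun k => ξ k y) : Submodule ℝ (Coord 4))

/-- The orthogonal complement of the Killing vectors. -/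
def orthPlane (G : Coord 4 → Matrix (Fin 4) (Fin 4) ℝ) (ξ : Fin 2 → Coord 4 → Coord 4)
    (y : Coord 4) : Set (Coord 4) :=
  {v | ∀ k, ip (G y) (ξ k y) v = 0}

/-- A null tetrad at `y` adapted to the splitting `Ξ ⊕ Ξ^⊥`: the real null vectors lie in one of
the two planes, the complex ones in the complexification of the other. -/
def IsAdaptedTetrad (G : Coord 4 → Matrix (Fin 4) (Fin 4) ℝ) (ξ : Fin 2 → Coord 4 → Coord 4)
    (y : Coord 4) (k l : Coord 4) (m : Fin 4 → ℂ) : Prop :=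
  IsNullTetrad (G y) k l m ∧
    ((k ∈ killingPlane ξ y ∧ l ∈ killingPlane ξ y ∧
        reV m ∈ orthPlane G ξ y ∧ imV m ∈ orthPlane G ξ y) ∨
      (k ∈ orthPlane G ξ y ∧ l ∈ orthPlane G ξ y ∧
        reV m ∈ killingPlane ξ y ∧ imV m ∈ killingPlane ξ y))

/-- `Ψ₂ = C_{abcd} kᵃ mᵇ m̄ᶜ lᵈ`. -/
def psi2 (G : Coord 4 → Matrix (Fin 4) (Fin 4) ℝ) (y : Coord 4) (k l : Coord 4)
    (m : Fin 4 → ℂ) : ℂ :=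
  ∑ a, ∑ b, ∑ c, ∑ d, (weyl G y a b c d : ℂ) * toC k a * m b * conj (m c) * toC l d

/-! ### Metrics and vector fields on a four-dimensional manifold -/

section Manifold

variable {M : Type*} [TopologicalSpace M] [ChartedSpace (Coord 4) M]

/-- Components of a field of bilinear forms with respect to the coordinates of the chart `φ`. -/
def metricInChart (gM : ∀ p : M, LinearMap.BilinForm ℝ (TangentSpace 𝓘(ℝ, Coord 4) p))
    (φ : OpenPartialHomeomorph M (Coord 4)) (y : Coord 4) : Matrix (Fin 4) (Fin 4) ℝ :=
  Matrix.of fun a b => gM (φ.symm y)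
    (mfderiv 𝓘(ℝ, Coord 4) 𝓘(ℝ, Coord 4) φ.symm y (coordVec a : Coord 4))
    (mfderiv 𝓘(ℝ, Coord 4) 𝓘(ℝ, Coord 4) φ.symm y (coordVec b : Coord 4))

/-- Components of the vector fields `ξ₁, ξ₂` with respect to the coordinates of the chart `φ`. -/
def fieldsInChart (ξ : Fin 2 → ∀ p : M, TangentSpace 𝓘(ℝ, Coord 4) p)
    (φ : OpenPartialHomeomorph M (Coord 4)) (k : Fin 2) (y : Coord 4) : Coord 4 :=
  mfderiv 𝓘(ℝ, Coord 4) 𝓘(ℝ, Coord 4) φ (φ.symm y) (ξ k (φ.symm y))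

/-- The smooth charts of `M`. -/
def smoothCharts (M : Type*) [TopologicalSpace M] [ChartedSpace (Coord 4) M] :
    Set (OpenPartialHomeomorph M (Coord 4)) :=
  IsManifold.maximalAtlas 𝓘(ℝ, Coord 4) ∞ M

/-- `gM` is a smooth pseudo-Riemannian metric on `M` with the orthogonally transitive pair
`ξ₁, ξ₂` of commuting Killing fields. -/
def IsOrthogonallyTransitivePair
    (gM : ∀ p : M, LinearMap.BilinForm ℝ (TangentSpace 𝓘(ℝ, Coord 4) p))
    (ξ : Fin 2 → ∀ p : M, TangentSpace 𝓘(ℝ, Coord 4) p) : Prop :=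
  ∀ φ ∈ smoothCharts M,
    IsTransitivePairOn (metricInChart gM φ) (fieldsInChart ξ φ) φ.target

/-- Lorentz metric: signature `(-+++)` or `(+---)`, that is, negative determinant. -/
def IsLorentz (gM : ∀ p : M, LinearMap.BilinForm ℝ (TangentSpace 𝓘(ℝ, Coord 4) p)) : Prop :=
  ∀ φ ∈ smoothCharts M, ∀ y ∈ φ.target, (metricInChart gM φ y).det < 0

/-- Einstein's vacuum equations with cosmological constant `Λ`. -/
def IsVacuum (gM : ∀ p : M, LinearMap.BilinForm ℝ (TangentSpace 𝓘(ℝ, Coord 4) p)) (Λ : ℝ) :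
    Prop :=
  ∀ φ ∈ smoothCharts M, ∀ y ∈ φ.target, ∀ a b,
    ricci (metricInChart gM φ) y a b
      - (1 / 2) * scalarCurv (metricInChart gM φ) y * metricInChart gM φ y a b
      + Λ * metricInChart gM φ y a b = 0

/-- 1-jet at `t` of the pair `(g, h)` which the metric induces on the leaf `σ`, written in the
chart `φ`. -/
def leafJet (gM : ∀ p : M, LinearMap.BilinForm ℝ (TangentSpace 𝓘(ℝ, Coord 4) p))
    (ξ : Fin 2 → ∀ p : M, TangentSpace 𝓘(ℝ, Coord 4) p)
    (φ : OpenPartialHomeomorph M (Coord 4)) (σ : Coord 2 → Coord 4) (t : Coord 2) : OneJet :=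
  jet (leafMetric (metricInChart gM φ) σ) (leafGram (metricInChart gM φ) (fieldsInChart ξ φ) σ) t

end Manifold

end TwoKilling

end

open TwoKilling

/-! Write `h` for the Gram matrix of the Killing fields, `e₀, e₁` for the coordinate frame of a
leaf. Everything rests on one fact: the curvature components `R(ξ₀, ξ₁, u, v)` contain only first
derivatives of the data. For commuting Killing fields `d h_{kl}(v) = 2 g(∇_v ξ_k, ξ_l)`, and
symmetry of the second derivative of `h_{kl}` turns this into `g(R(u,v) ξ_k, ξ_l) = g(∇_u ξ_k, ∇_v
ξ_l) - g(∇_v ξ_k, ∇_u ξ_l)` (`IsCommutingKillingAt.metric_curv`). The components of `∇ξ_k` with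
respect to the orthogonal planes `Ξ` and `Ξ^⊥` are zero or `± dh / 2`. Hence the sectional curvature
of `Ξ` is `-C_χ / 4` (`IsKillingLeaf.curvForm_orbit`), and `Q_γ = 4 R(ξ₀, ξ₁, e₀, e₁)² / (det h ·
det g)` (`IsKillingLeaf.Qgamma_eq`).

The leaves are totally geodesic, because an antisymmetric form (Killing) is minus a symmetric one
(second fundamental form). So half the scalar curvature of a leaf is the ambient sectional curvature
of `Ξ^⊥`. For an Einstein metric in dimension four, complementary orthogonal planes have equal
sectional curvatures (`IsCurvatureForm.einstein_planes`); this gives `R = -C_χ / 2`.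

For an adapted tetrad with `m = a + i b`, the Ricci part of the Weyl tensor drops out of `Im Ψ₂`,
and the Bianchi identity leaves `R(k, l, a, b)`. In the Einstein case `Re Ψ₂ = Λ/6 + R(k, l, k,
l)/2`. Both components depend on the two planes only through the area factors of the pairs `(k, l)`
and `(a, b)`, which the tetrad normalization fixes up to sign (`IsCurvatureForm.tetrad`).

Invariance is a separate matrix computation: `χ` and `γ` are tensors on the surface, and do not
change when the Killing basis does, so the trace `C_χ` and the ratio of determinants `Q_γ` are
scalars. -/

noncomputable section

namespace TwoKilling

/-! ### Connections along maps, symmetries of curvature, and commuting Killing fields -/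

section Connection

variable {E F : Type*} [NormedAddCommGroup E] [NormedSpace ℝ E]
  [NormedAddCommGroup F] [NormedSpace ℝ F]

/-- Curvature `R(u, v) w` of the connection with Christoffel map `Γ`. -/
def curv (Γ : E → E →L[ℝ] E →L[ℝ] E) (y u v w : E) : E :=
  fderiv ℝ Γ y u v w - fderiv ℝ Γ y v u w + Γ y u (Γ y v w) - Γ y v (Γ y u w)

/-- Covariant derivative, in the direction `v`, of a vector field `Z` along the map `f`. -/
def covAlong (Γ : E → E →L[ℝ] E →L[ℝ] E) (f Z : F → E) (v s : F) : E :=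
  fderiv ℝ Z s v + Γ (f s) (fderiv ℝ f s v) (Z s)

variable {Γ : E → E →L[ℝ] E →L[ℝ] E} {g : E → E →L[ℝ] E →L[ℝ] ℝ}

theorem hasFDerivAt_fderiv_apply {G : Type*} [NormedAddCommGroup G] [NormedSpace ℝ G]
    {f : F → G} {t : F} (hf : ContDiffAt ℝ 2 f t) (v : F) :
    HasFDerivAt (fun s => fderiv ℝ f s v) ((fderiv ℝ (fderiv ℝ f) t).flip v) t := by
  have h : DifferentiableAt ℝ (fderiv ℝ f) t :=
    (hf.fderiv_right (m := 1) (by norm_num)).differentiableAt (by norm_num)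
  simpa using h.hasFDerivAt.clm_apply (hasFDerivAt_const v t)

theorem fderiv_fderiv_comm {G : Type*} [NormedAddCommGroup G] [NormedSpace ℝ G]
    {f : F → G} {t : F} (hf : ContDiffAt ℝ 2 f t) (u v : F) :
    fderiv ℝ (fderiv ℝ f) t u v = fderiv ℝ (fderiv ℝ f) t v u :=
  (hf.isSymmSndFDerivAt (by simp)).eq u v

theorem hasFDerivAt_covAlong {f Z : F → E} {t : F} (hΓ : DifferentiableAt ℝ Γ (f t))
    (hf : ContDiffAt ℝ 2 f t) (hZ : ContDiffAt ℝ 2 Z t) (v : F) :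
    ∃ D : F →L[ℝ] E, HasFDerivAt (covAlong Γ f Z v) D t ∧ ∀ u, D u =
      fderiv ℝ (fderiv ℝ Z) t u v + fderiv ℝ Γ (f t) (fderiv ℝ f t u) (fderiv ℝ f t v) (Z t)
        + Γ (f t) (fderiv ℝ (fderiv ℝ f) t u v) (Z t)
        + Γ (f t) (fderiv ℝ f t v) (fderiv ℝ Z t u) := by
  have h1 := hasFDerivAt_fderiv_apply hZ v
  have h2 := hasFDerivAt_fderiv_apply hf v
  have h3 : HasFDerivAt (fun s => Γ (f s)) ((fderiv ℝ Γ (f t)).comp (fderiv ℝ f t)) t :=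
    HasFDerivAt.comp (g := Γ) t hΓ.hasFDerivAt (hf.differentiableAt (by norm_num)).hasFDerivAt
  have h4 := h1.add ((h3.clm_apply h2).clm_apply (hZ.differentiableAt (by norm_num)).hasFDerivAt)
  refine ⟨_, h4, fun u => ?_⟩
  simp
  abel

/-- The commutator of covariant derivatives along a map is the curvature. -/
theorem covAlong_comm {f Z : F → E} {t : F} (hΓ : DifferentiableAt ℝ Γ (f t))
    (hf : ContDiffAt ℝ 2 f t) (hZ : ContDiffAt ℝ 2 Z t) (u v : F) :
    covAlong Γ f (covAlong Γ f Z v) u t - covAlong Γ f (covAlong Γ f Z u) v t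
      = curv Γ (f t) (fderiv ℝ f t u) (fderiv ℝ f t v) (Z t) := by
  obtain ⟨Dv, hv, hv'⟩ := hasFDerivAt_covAlong hΓ hf hZ v
  obtain ⟨Du, hu, hu'⟩ := hasFDerivAt_covAlong hΓ hf hZ u
  have ev : covAlong Γ f (covAlong Γ f Z v) u t
      = Dv u + Γ (f t) (fderiv ℝ f t u) (covAlong Γ f Z v t) := by rw [covAlong, hv.fderiv]
  have eu : covAlong Γ f (covAlong Γ f Z u) v t
      = Du v + Γ (f t) (fderiv ℝ f t v) (covAlong Γ f Z u t) := by rw [covAlong, hu.fderiv]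
  rw [ev, eu, hv', hu', fderiv_fderiv_comm hZ v u, fderiv_fderiv_comm hf v u]
  simp only [covAlong, curv, map_add]
  abel

/-- At `y`, the Christoffel map `Γ` is that of the Levi-Civita connection of `g`. -/
structure IsLeviCivitaAt (Γ : E → E →L[ℝ] E →L[ℝ] E) (g : E → E →L[ℝ] E →L[ℝ] ℝ)
    (y : E) : Prop where
  torsion : ∀ u v, Γ y u v = Γ y v u
  symm : ∀ u v, g y u v = g y v u
  metric : ∀ u v w, fderiv ℝ g y u v w = g y (Γ y u v) w + g y v (Γ y u w)

/-- Metric compatibility along a map. It serves twice: with `f = id` for fields on the ambient space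
and with `f` a parametrized leaf. -/
theorem hasFDerivAt_metric_along {f Y Z : F → E} {t : F} (hL : IsLeviCivitaAt Γ g (f t))
    (hg : DifferentiableAt ℝ g (f t)) (hf : DifferentiableAt ℝ f t)
    (hY : DifferentiableAt ℝ Y t) (hZ : DifferentiableAt ℝ Z t) :
    ∃ D : F →L[ℝ] ℝ, HasFDerivAt (fun s => g (f s) (Y s) (Z s)) D t ∧ ∀ u, D u =
      g (f t) (covAlong Γ f Y u t) (Z t) + g (f t) (Y t) (covAlong Γ f Z u t) := by
  have h1 : HasFDerivAt (fun s => g (f s)) ((fderiv ℝ g (f t)).comp (fderiv ℝ f t)) t :=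
    HasFDerivAt.comp (g := g) t hg.hasFDerivAt hf.hasFDerivAt
  have h := (h1.clm_apply hY.hasFDerivAt).clm_apply hZ.hasFDerivAt
  refine ⟨_, h, fun u => ?_⟩
  simp [covAlong, hL.metric]
  ring

theorem fderiv_metric_along {f Y Z : F → E} {t : F} (hL : IsLeviCivitaAt Γ g (f t))
    (hg : DifferentiableAt ℝ g (f t)) (hf : DifferentiableAt ℝ f t)
    (hY : DifferentiableAt ℝ Y t) (hZ : DifferentiableAt ℝ Z t) (u : F) :
    fderiv ℝ (fun s => g (f s) (Y s) (Z s)) t u =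
      g (f t) (covAlong Γ f Y u t) (Z t) + g (f t) (Y t) (covAlong Γ f Z u t) := by
  obtain ⟨D, hD, hD'⟩ := hasFDerivAt_metric_along hL hg hf hY hZ
  rw [hD.fderiv, hD']

theorem curv_antisymm (y u v w : E) : curv Γ y u v w = -curv Γ y v u w := by
  simp only [curv]; abel

/-- Vanishing torsion is assumed on a whole neighbourhood, so the symmetry of `Γ` may be
differentiated. -/
theorem fderiv_apply_symm {y : E} (h : ∀ᶠ z in nhds y, IsLeviCivitaAt Γ g z)
    (hΓ : DifferentiableAt ℝ Γ y) (u v w : E) :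
    fderiv ℝ Γ y u v w = fderiv ℝ Γ y u w v := by
  have key (v w : E) : fderiv ℝ (fun z => Γ z v w) y u = fderiv ℝ Γ y u v w := by
    rw [((hΓ.hasFDerivAt.clm_apply (hasFDerivAt_const v y)).clm_apply
      (hasFDerivAt_const w y)).fderiv]
    simp
  rw [← key, ← key]
  congr 1
  exact Filter.EventuallyEq.fderiv_eq (h.mono fun z hz => hz.torsion v w)

theorem curv_bianchi {y : E} (h : ∀ᶠ z in nhds y, IsLeviCivitaAt Γ g z)
    (hΓ : DifferentiableAt ℝ Γ y) (u v w : E) :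
    curv Γ y u v w + curv Γ y v w u + curv Γ y w u v = 0 := by
  have ht := h.self_of_nhds.torsion
  simp only [curv]
  rw [fderiv_apply_symm h hΓ u v w, fderiv_apply_symm h hΓ v u w, fderiv_apply_symm h hΓ w u v,
    ht v w, ht u w, ht u v]
  abel

/-- For constant `w` and `x` the second derivative of `g(w, x)` is symmetric; expressed by covariant
derivatives, its antisymmetric part is `g(R(u,v) w, x) + g(w, R(u,v) x)`. -/
theorem metric_curv_antisymm {y : E} (h : ∀ᶠ z in nhds y, IsLeviCivitaAt Γ g z)
    (hΓ : DifferentiableAt ℝ Γ y) (hg : ContDiffAt ℝ 2 g y) (u v w x : E) :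
    g y (curv Γ y u v w) x = -g y (curv Γ y u v x) w := by
  have hL := h.self_of_nhds
  have hc (w : E) : ContDiffAt ℝ 2 (fun _ : E => w) y := contDiffAt_const
  have hid : ContDiffAt ℝ 2 (id : E → E) y := contDiffAt_id
  have hgd : DifferentiableAt ℝ g y := hg.differentiableAt (by norm_num)
  have hgd' : ∀ᶠ z in nhds y, DifferentiableAt ℝ g z :=
    (hg.eventually (by simp)).mono fun z hz => hz.differentiableAt (by norm_num)
  have hC (v w : E) : DifferentiableAt ℝ (covAlong Γ id (fun _ : E => w) v) y :=
    (hasFDerivAt_covAlong (f := id) hΓ hid (hc w) v).choose_spec.1.differentiableAt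
  have hgwx : ContDiffAt ℝ 2 (fun z => g z w x) y :=
    (hg.clm_apply contDiffAt_const).clm_apply contDiffAt_const
  have key (u v : E) : fderiv ℝ (fderiv ℝ fun z => g z w x) y u v =
      g y (covAlong Γ id (covAlong Γ id (fun _ => w) v) u y) x
      + g y (covAlong Γ id (fun _ => w) v y) (covAlong Γ id (fun _ => x) u y)
      + (g y (covAlong Γ id (fun _ => w) u y) (covAlong Γ id (fun _ => x) v y)
      + g y w (covAlong Γ id (covAlong Γ id (fun _ => x) v) u y)) := by
    have h1 : (fun z => fderiv ℝ (fun z => g z w x) z v) =ᶠ[nhds y] fun z =>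
        g (id z) (covAlong Γ id (fun _ => w) v z) x
          + g (id z) w (covAlong Γ id (fun _ => x) v z) := by
      filter_upwards [h, hgd'] with z hz hz'
      exact fderiv_metric_along (f := id) hz hz' differentiableAt_id
        (differentiableAt_const w) (differentiableAt_const x) v
    have h2 := h1.fderiv_eq (𝕜 := ℝ)
    rw [(hasFDerivAt_fderiv_apply hgwx v).fderiv] at h2
    have h3 := congrArg (fun L => L u) h2
    simp only [ContinuousLinearMap.flip_apply] at h3
    obtain ⟨D1, hD1, hD1'⟩ := hasFDerivAt_metric_along (f := id) (t := y) hL hgd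
      differentiableAt_id (hC v w) (differentiableAt_const x)
    obtain ⟨D2, hD2, hD2'⟩ := hasFDerivAt_metric_along (f := id) (t := y) hL hgd
      differentiableAt_id (differentiableAt_const w) (hC v x)
    rw [h3, (hD1.fun_add hD2).fderiv, add_apply, hD1', hD2']
    rfl
  have e := fderiv_fderiv_comm hgwx u v
  rw [key, key] at e
  have c1 := covAlong_comm (f := id) (t := y) hΓ hid (hc w) u v
  have c2 := covAlong_comm (f := id) (t := y) hΓ hid (hc x) u v
  simp only [fderiv_id, ContinuousLinearMap.id_apply, id] at c1 c2
  rw [← c1, ← c2, hL.symm _ w]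
  simp only [map_sub, sub_apply]
  linarith

theorem metric_curv_pair_symm {y : E} (h : ∀ᶠ z in nhds y, IsLeviCivitaAt Γ g z)
    (hΓ : DifferentiableAt ℝ Γ y) (hg : ContDiffAt ℝ 2 g y) (u v w x : E) :
    g y (curv Γ y u v w) x = g y (curv Γ y w x u) v := by
  have b (a b c d : E) : g y (curv Γ y a b c) d + g y (curv Γ y b c a) d
      + g y (curv Γ y c a b) d = 0 := by
    have := congrArg (fun z => g y z d) (curv_bianchi h hΓ a b c)
    simpa using this
  have s (a b c d : E) : g y (curv Γ y a b c) d = -g y (curv Γ y b a c) d := by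
    rw [curv_antisymm]; simp
  have m := metric_curv_antisymm h hΓ hg
  -- The classical argument: four instances of the Bianchi identity, combined by means of the
  -- antisymmetry in each pair.
  linarith [b u v w x, b v w x u, b w x u v, b x u v w, s u v w x, s v w u x, s w u v x,
    s v w x u, s w x v u, s x v w u, s w x u v, s x u w v, s u w x v, s x u v w, s u v x w,
    s v x u w, m u v w x, m v w u x, m w u v x, m w x u v, m x u v w, m v x u w, m u w x v,
    m w x v u, m x v w u]

/-- Near a point, `ξ` is a family of Killing fields commuting with each other. -/
structure IsCommutingKillingAt {ι : Type*} (Γ : E → E →L[ℝ] E →L[ℝ] E)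
    (g : E → E →L[ℝ] E →L[ℝ] ℝ) (ξ : ι → E → E) (y : E) : Prop where
  levi : IsLeviCivitaAt Γ g y
  diff_christoffel : DifferentiableAt ℝ Γ y
  smooth_metric : ContDiffAt ℝ 2 g y
  smooth_field : ∀ k, ContDiffAt ℝ 2 (ξ k) y
  killing : ∀ k v w, g y (covAlong Γ id (ξ k) v y) w + g y (covAlong Γ id (ξ k) w y) v = 0
  commute : ∀ k l, covAlong Γ id (ξ k) (ξ l y) y = covAlong Γ id (ξ l) (ξ k y) y

/-- The product rule gives two terms. The Killing equations for `ξ_k` and `ξ_l`, with `∇_{ξ_k} ξ_l =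
∇_{ξ_l} ξ_k` between them, make these terms equal. -/
theorem IsCommutingKillingAt.fderiv_gram {ι : Type*} {ξ : ι → E → E} {y : E}
    (h : IsCommutingKillingAt Γ g ξ y) (k l : ι) (v : E) :
    fderiv ℝ (fun z => g z (ξ k z) (ξ l z)) y v = 2 * g y (covAlong Γ id (ξ k) v y) (ξ l y) := by
  have h1 := fderiv_metric_along (f := id) (t := y) h.levi
    (h.smooth_metric.differentiableAt (by norm_num)) differentiableAt_id
    ((h.smooth_field k).differentiableAt (by norm_num))
    ((h.smooth_field l).differentiableAt (by norm_num)) v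
  simp only [id] at h1
  rw [h1, h.levi.symm (ξ k y)]
  have h2 := h.killing l v (ξ k y)
  have h3 := h.killing k v (ξ l y)
  rw [h.commute] at h2
  linarith

/-- The source of all first-order formulas: differentiating `2 g(∇_v ξ_k, ξ_l)` once more and
antisymmetrizing must give zero, and the second covariant derivatives of `ξ_k` combine into
curvature. -/
theorem IsCommutingKillingAt.metric_curv {ι : Type*} {ξ : ι → E → E} {y : E}
    (h : ∀ᶠ z in nhds y, IsCommutingKillingAt Γ g ξ z) (k l : ι) (u v : E) :
    g y (curv Γ y u v (ξ k y)) (ξ l y) =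
      g y (covAlong Γ id (ξ k) u y) (covAlong Γ id (ξ l) v y)
      - g y (covAlong Γ id (ξ k) v y) (covAlong Γ id (ξ l) u y) := by
  have h0 := h.self_of_nhds
  have hid : ContDiffAt ℝ 2 (id : E → E) y := contDiffAt_id
  have hgd := h0.smooth_metric.differentiableAt (by norm_num)
  have hgram : ContDiffAt ℝ 2 (fun z => g z (ξ k z) (ξ l z)) y :=
    (h0.smooth_metric.clm_apply (h0.smooth_field k)).clm_apply (h0.smooth_field l)
  have hC (v : E) : DifferentiableAt ℝ (covAlong Γ id (ξ k) v) y :=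
    (hasFDerivAt_covAlong (f := id) h0.diff_christoffel hid
      (h0.smooth_field k) v).choose_spec.1.differentiableAt
  have key (u v : E) : fderiv ℝ (fderiv ℝ fun z => g z (ξ k z) (ξ l z)) y u v =
      2 * (g y (covAlong Γ id (covAlong Γ id (ξ k) v) u y) (ξ l y)
        + g y (covAlong Γ id (ξ k) v y) (covAlong Γ id (ξ l) u y)) := by
    have h1 : (fun z => fderiv ℝ (fun z => g z (ξ k z) (ξ l z)) z v) =ᶠ[nhds y] fun z =>
        2 * g (id z) (covAlong Γ id (ξ k) v z) (ξ l z) :=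
      h.mono fun z hz => hz.fderiv_gram k l v
    have h2 := h1.fderiv_eq (𝕜 := ℝ)
    rw [(hasFDerivAt_fderiv_apply hgram v).fderiv] at h2
    obtain ⟨D, hD, hD'⟩ := hasFDerivAt_metric_along (f := id) (t := y) h0.levi hgd
      differentiableAt_id (hC v) ((h0.smooth_field l).differentiableAt (by norm_num))
    have h3 := congrArg (fun L => L u) (h2.trans (hD.const_mul (2 : ℝ)).fderiv)
    simpa [hD'] using h3
  have e := fderiv_fderiv_comm hgram u v
  rw [key, key] at e
  have c := covAlong_comm (f := id) (t := y) h0.diff_christoffel hid (h0.smooth_field k) u v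
  simp only [fderiv_id, ContinuousLinearMap.id_apply, id] at c
  rw [← c]
  simp only [map_sub, sub_apply]
  linarith

end Connection

/-! ### Comparison with Christoffel symbols and curvature in coordinates -/

section Coordinates

variable {n : ℕ}

theorem coordVec_apply (a b : Fin n) : coordVec a b = if b = a then (1 : ℝ) else 0 := by
  simp [coordVec]

theorem sum_smul_coordVec (u : Coord n) : ∑ a, u a • coordVec a = u := by
  ext b
  simp [coordVec_apply]

theorem IsLinearMap.sum_coordVec {V : Type*} [AddCommGroup V] [Module ℝ V] {T : Coord n → V}
    (hT : IsLinearMap ℝ T) (u : Coord n) : ∑ a, u a • T (coordVec a) = T u := by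
  have h := map_sum (hT.mk' T) (fun a => u a • coordVec a) Finset.univ
  rw [sum_smul_coordVec] at h
  simpa [hT.map_smul] using h.symm

theorem linear_ext {T : Coord n → ℝ} (hT : IsLinearMap ℝ T) (h : ∀ a, T (coordVec a) = 0)
    (u : Coord n) : T u = 0 := by
  rw [← IsLinearMap.sum_coordVec hT u]
  simp [h]

theorem contDiffAt_smul_vec {V : Type*} [NormedAddCommGroup V] [NormedSpace ℝ V]
    {m : WithTop ℕ∞} {f : Coord n → ℝ} {y : Coord n} (hf : ContDiffAt ℝ m f y) (B : V) :
    ContDiffAt ℝ m (fun z => f z • B) y :=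
  hf.smul contDiffAt_const

theorem fderiv_apply_apply {V W : Type*} [NormedAddCommGroup V] [NormedSpace ℝ V]
    [NormedAddCommGroup W] [NormedSpace ℝ W] {B : V → V →L[ℝ] V →L[ℝ] W} {y : V}
    (hB : DifferentiableAt ℝ B y) (u v w : V) :
    fderiv ℝ (fun z => B z v w) y u = fderiv ℝ B y u v w := by
  rw [((hB.hasFDerivAt.clm_apply (hasFDerivAt_const v y)).clm_apply
    (hasFDerivAt_const w y)).fderiv]
  simp

/-- The bilinear form with the components `G`. -/
def metricMap (G : Coord n → Matrix (Fin n) (Fin n) ℝ) (y : Coord n) :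
    Coord n →L[ℝ] Coord n →L[ℝ] ℝ :=
  ∑ a, ∑ b, G y a b • (EuclideanSpace.proj a : Coord n →L[ℝ] ℝ).smulRight
    (EuclideanSpace.proj b : Coord n →L[ℝ] ℝ)

/-- The Christoffel symbols as a bilinear map. -/
def christoffelMap (G : Coord n → Matrix (Fin n) (Fin n) ℝ) (y : Coord n) :
    Coord n →L[ℝ] Coord n →L[ℝ] Coord n :=
  ∑ c, ∑ a, ∑ b, christoffel G c a b y • (EuclideanSpace.proj a : Coord n →L[ℝ] ℝ).smulRight
    ((EuclideanSpace.proj b : Coord n →L[ℝ] ℝ).smulRight (coordVec c : Coord n))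

variable {G : Coord n → Matrix (Fin n) (Fin n) ℝ}

theorem metricMap_apply (y u v : Coord n) : metricMap G y u v = ip (G y) u v := by
  simp [metricMap, ip, mul_assoc]

theorem metricMap_coordVec (y : Coord n) (a b : Fin n) :
    metricMap G y (coordVec a) (coordVec b) = G y a b := by
  simp [metricMap_apply, ip, coordVec_apply]

theorem christoffelMap_coordVec (y : Coord n) (c a b : Fin n) :
    christoffelMap G y (coordVec a) (coordVec b) c = christoffel G c a b y := by
  simp [christoffelMap, coordVec_apply]

theorem contDiffAt_metricMap {m : WithTop ℕ∞} {y : Coord n}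
    (hG : ∀ a b, ContDiffAt ℝ m (fun z => G z a b) y) : ContDiffAt ℝ m (metricMap G) y :=
  ContDiffAt.sum fun a _ => ContDiffAt.sum fun b _ => contDiffAt_smul_vec (hG a b) _

theorem contDiffAt_det {k : ℕ} {m : WithTop ℕ∞} {A : Coord n → Matrix (Fin k) (Fin k) ℝ}
    {y : Coord n} (hA : ∀ a b, ContDiffAt ℝ m (fun z => A z a b) y) :
    ContDiffAt ℝ m (fun z => (A z).det) y := by
  simp only [Matrix.det_apply]
  exact ContDiffAt.sum fun s _ => (contDiffAt_prod fun i _ => hA _ _).const_smul _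

theorem contDiffAt_inv {k : ℕ} {m : WithTop ℕ∞} {A : Coord n → Matrix (Fin k) (Fin k) ℝ}
    {y : Coord n} (hA : ∀ a b, ContDiffAt ℝ m (fun z => A z a b) y) (h0 : (A y).det ≠ 0)
    (a b : Fin k) : ContDiffAt ℝ m (fun z => (A z)⁻¹ a b) y := by
  simp only [Matrix.inv_def, Ring.inverse_eq_inv', Matrix.smul_apply, Matrix.adjugate_apply]
  refine ((contDiffAt_det hA).inv h0).smul (contDiffAt_det fun c d => ?_)
  by_cases hc : c = b
  · subst hc; simpa using contDiffAt_const
  · simpa [Matrix.updateRow_apply, hc] using hA c d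

theorem contDiffAt_pd {f : Coord n → ℝ} {y : Coord n} (hf : ContDiffAt ℝ ∞ f y) (a : Fin n) :
    ContDiffAt ℝ ∞ (pd a f) y :=
  (hf.fderiv_right (m := ∞) (by simp)).clm_apply contDiffAt_const

theorem contDiffAt_christoffel {y : Coord n} (hG : ∀ a b, ContDiffAt ℝ ∞ (fun z => G z a b) y)
    (h0 : (G y).det ≠ 0) (c a b : Fin n) : ContDiffAt ℝ ∞ (christoffel G c a b) y := by
  refine contDiffAt_const.mul (ContDiffAt.sum fun d _ => ?_)
  exact (contDiffAt_inv hG h0 c d).mul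
    (((contDiffAt_pd (hG b d) a).add (contDiffAt_pd (hG a d) b)).sub (contDiffAt_pd (hG a b) d))

theorem contDiffAt_christoffelMap {y : Coord n}
    (hG : ∀ a b, ContDiffAt ℝ ∞ (fun z => G z a b) y)
    (h0 : (G y).det ≠ 0) : ContDiffAt ℝ ∞ (christoffelMap G) y :=
  ContDiffAt.sum fun c _ => ContDiffAt.sum fun a _ => ContDiffAt.sum fun b _ =>
    contDiffAt_smul_vec (contDiffAt_christoffel hG h0 c a b) _

theorem pd_symm {y : Coord n} (hs : ∀ᶠ z in nhds y, (G z).IsSymm) (c a b : Fin n) :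
    pd c (fun z => G z a b) y = pd c (fun z => G z b a) y := by
  have : (fun z => G z a b) =ᶠ[nhds y] fun z => G z b a := hs.mono fun z hz => hz.apply b a
  rw [pd, pd, this.fderiv_eq]

/-- The Koszul formula: lowering the upper index cancels the inverse metric. It is applied both to
the ambient metric and to the metric of a leaf. -/
theorem sum_metric_christoffel {y : Coord n} (hs : (G y).IsSymm) (h0 : (G y).det ≠ 0)
    (a b e : Fin n) : ∑ c, G y c e * christoffel G c a b y = (1 / 2) *
      (pd a (fun z => G z b e) y + pd b (fun z => G z a e) y - pd e (fun z => G z a b) y) := by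
  have h1 : (G y * (G y)⁻¹) = 1 := Matrix.mul_nonsing_inv _ (isUnit_iff_ne_zero.2 h0)
  have h2 (d : Fin n) : ∑ c, G y c e * (G y)⁻¹ c d = if e = d then 1 else 0 := by
    rw [← Matrix.one_apply, ← h1, Matrix.mul_apply]
    exact Finset.sum_congr rfl fun c _ => by rw [hs.apply]
  simp only [christoffel, Finset.mul_sum]
  rw [Finset.sum_comm]
  have h3 (d : Fin n) (T : ℝ) : ∑ c, G y c e * (1 / 2 * ((G y)⁻¹ c d * T))
      = 1 / 2 * ((if e = d then 1 else 0) * T) := by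
    rw [← h2, Finset.sum_mul, Finset.mul_sum]
    exact Finset.sum_congr rfl fun c _ => by ring
  simp_rw [h3]
  simp

theorem christoffel_symm {y : Coord n} (hs : ∀ᶠ z in nhds y, (G z).IsSymm) (c a b : Fin n) :
    christoffel G c a b y = christoffel G c b a y := by
  simp only [christoffel]
  congr 1
  refine Finset.sum_congr rfl fun d _ => ?_
  rw [pd_symm hs d a b]
  ring

theorem fderiv_metricMap {y : Coord n} (hG : ∀ a b, ContDiffAt ℝ ∞ (fun z => G z a b) y)
    (c a b : Fin n) :
    fderiv ℝ (metricMap G) y (coordVec c) (coordVec a) (coordVec b)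
      = pd c (fun z => G z a b) y := by
  have hd : DifferentiableAt ℝ (metricMap G) y :=
    (contDiffAt_metricMap hG).differentiableAt (by simp)
  rw [← fderiv_apply_apply hd, pd]
  simp only [metricMap_coordVec]

theorem isLeviCivitaAt {y : Coord n} (hG : ∀ a b, ContDiffAt ℝ ∞ (fun z => G z a b) y)
    (hs : ∀ᶠ z in nhds y, (G z).IsSymm) (h0 : (G y).det ≠ 0) :
    IsLeviCivitaAt (christoffelMap G) (metricMap G) y := by
  have hs0 := hs.self_of_nhds
  have hΓ (a b e : Fin n) :
      metricMap G y (christoffelMap G y (coordVec a) (coordVec b)) (coordVec e) = (1 / 2) *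
      (pd a (fun z => G z b e) y + pd b (fun z => G z a e) y - pd e (fun z => G z a b) y) := by
    rw [← sum_metric_christoffel hs0 h0 a b e, metricMap_apply]
    simp [ip, christoffelMap_coordVec, coordVec_apply]
  have hsymm (u v : Coord n) : metricMap G y u v = metricMap G y v u := by
    simp only [metricMap_apply, ip]
    rw [Finset.sum_comm]
    exact Finset.sum_congr rfl fun a _ => Finset.sum_congr rfl fun b _ => by
      rw [hs0.apply]; ring
  refine ⟨fun u v => ?_, hsymm, fun u v w => ?_⟩
  · rw [← sub_eq_zero]
    ext c
    refine linear_ext (T := fun u => (christoffelMap G y u v - christoffelMap G y v u) c) ?_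
      (fun a => ?_) u
    · constructor <;> intros <;> simp <;> ring
    refine linear_ext (T := fun v => (christoffelMap G y (coordVec a) v
      - christoffelMap G y v (coordVec a)) c) ?_ (fun b => ?_) v
    · constructor <;> intros <;> simp <;> ring
    simp [christoffelMap_coordVec, christoffel_symm hs c a b]
  · rw [← sub_eq_zero]
    refine linear_ext (T := fun u => fderiv ℝ (metricMap G) y u v w
      - (metricMap G y (christoffelMap G y u v) w + metricMap G y v (christoffelMap G y u w)))
      ?_ (fun c => ?_) u
    · constructor <;> intros <;> simp <;> ring
    refine linear_ext (T := fun v => fderiv ℝ (metricMap G) y (coordVec c) v w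
      - (metricMap G y (christoffelMap G y (coordVec c) v) w
        + metricMap G y v (christoffelMap G y (coordVec c) w))) ?_ (fun a => ?_) v
    · constructor <;> intros <;> simp <;> ring
    refine linear_ext (T := fun w => fderiv ℝ (metricMap G) y (coordVec c) (coordVec a) w
      - (metricMap G y (christoffelMap G y (coordVec c) (coordVec a)) w
        + metricMap G y (coordVec a) (christoffelMap G y (coordVec c) w))) ?_ (fun b => ?_) w
    · constructor <;> intros <;> simp <;> ring
    rw [fderiv_metricMap hG, hsymm (coordVec a), hΓ, hΓ, pd_symm hs c b a, pd_symm hs b c a,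
      pd_symm hs a c b]
    ring

/-- Fixes the index convention: the last two indices are the arguments of the curvature operator,
the second one is the vector acted upon. -/
theorem riemannUp_eq_curv {y : Coord n} (hG : ∀ a b, ContDiffAt ℝ ∞ (fun z => G z a b) y)
    (h0 : (G y).det ≠ 0) (a b c d : Fin n) : riemannUp G y a b c d
      = curv (christoffelMap G) y (coordVec c) (coordVec d) (coordVec b) a := by
  have hd : DifferentiableAt ℝ (christoffelMap G) y :=
    (contDiffAt_christoffelMap hG h0).differentiableAt (by simp)
  have hf (a b c d : Fin n) : fderiv ℝ (christoffelMap G) y (coordVec c) (coordVec d) (coordVec b) a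
      = pd c (christoffel G a d b) y := by
    have h := (EuclideanSpace.proj a : Coord n →L[ℝ] ℝ).hasFDerivAt.comp y
      ((hd.hasFDerivAt.clm_apply (hasFDerivAt_const (coordVec d) y)).clm_apply
        (hasFDerivAt_const (coordVec b) y))
    have e : (⇑(EuclideanSpace.proj a : Coord n →L[ℝ] ℝ) ∘ fun z =>
        christoffelMap G z (coordVec d) (coordVec b)) = christoffel G a d b := by
      funext z
      simp [christoffelMap_coordVec]
    rw [e] at h
    rw [pd, h.fderiv]
    simp
  have hg (v : Coord n) (c : Fin n) : christoffelMap G y (coordVec c) v a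
      = ∑ e, v e * christoffel G a c e y := by
    rw [← IsLinearMap.sum_coordVec (T := fun v => christoffelMap G y (coordVec c) v a) _ v]
    · simp [christoffelMap_coordVec]
    · constructor <;> intros <;> simp
  simp only [curv, PiLp.add_apply, PiLp.sub_apply, hf, riemannUp, hg, christoffelMap_coordVec,
    Finset.sum_sub_distrib]
  simp only [mul_comm]
  ring

theorem riemann_eq_curv {y : Coord n} (hG : ∀ a b, ContDiffAt ℝ ∞ (fun z => G z a b) y)
    (h0 : (G y).det ≠ 0) (a b c d : Fin n) : riemann G y a b c d = metricMap G y (coordVec a)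
      (curv (christoffelMap G) y (coordVec c) (coordVec d) (coordVec b)) := by
  simp only [riemann, riemannUp_eq_curv hG h0, metricMap_apply, ip, coordVec_apply]
  simp

end Coordinates

/-! ### Killing pairs in terms of the Levi-Civita connection -/

variable {G : Coord 4 → Matrix (Fin 4) (Fin 4) ℝ} {ξ : Fin 2 → Coord 4 → Coord 4}
  {U : Set (Coord 4)}

theorem IsTransitivePairOn.isCommutingKillingAt (h : IsTransitivePairOn G ξ U) (hU : IsOpen U)
    {y : Coord 4} (hy : y ∈ U) :
    IsCommutingKillingAt (christoffelMap G) (metricMap G) ξ y := by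
  have two_le : (2 : WithTop ℕ∞) ≤ ∞ := by norm_cast
  have hG (a b) : ContDiffAt ℝ ∞ (fun z => G z a b) y :=
    (h.metric_smooth a b).contDiffAt (hU.mem_nhds hy)
  have hs : ∀ᶠ z in nhds y, (G z).IsSymm := Filter.eventually_of_mem (hU.mem_nhds hy) h.metric_symm
  have hξ (k) : ContDiffAt ℝ ∞ (ξ k) y := (h.field_smooth k).contDiffAt (hU.mem_nhds hy)
  have hL := isLeviCivitaAt hG hs (h.metric_nondeg y hy)
  refine ⟨hL, (contDiffAt_christoffelMap hG (h.metric_nondeg y hy)).differentiableAt (by simp),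
    (contDiffAt_metricMap hG).of_le two_le, fun k => (hξ k).of_le
      two_le, fun k v w => ?_, fun k l => ?_⟩
  -- The Christoffel terms of the covariant Killing equation assemble, by metric compatibility and
  -- vanishing torsion, into the derivative of the metric along `ξ_k`: the Lie derivative.
  · have e : metricMap G y (covAlong (christoffelMap G) id (ξ k) v y) w
        + metricMap G y (covAlong (christoffelMap G) id (ξ k) w y) v
        = fderiv ℝ (metricMap G) y (ξ k y) v w + metricMap G y (fderiv ℝ (ξ k) y v) w
          + metricMap G y v (fderiv ℝ (ξ k) y w) := by
      simp only [covAlong, fderiv_id, ContinuousLinearMap.id_apply, id, hL.metric, map_add,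
        add_apply, hL.torsion v, hL.torsion w, hL.symm v]
      ring
    rw [e]
    refine linear_ext (T := fun v => fderiv ℝ (metricMap G) y (ξ k y) v w
      + metricMap G y (fderiv ℝ (ξ k) y v) w + metricMap G y v (fderiv ℝ (ξ k) y w)) ?_
      (fun a => ?_) v
    · constructor <;> intros <;> simp <;> ring
    refine linear_ext (T := fun w => fderiv ℝ (metricMap G) y (ξ k y) (coordVec a) w
      + metricMap G y (fderiv ℝ (ξ k) y (coordVec a)) w
      + metricMap G y (coordVec a) (fderiv ℝ (ξ k) y w)) ?_ (fun b => ?_) w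
    · constructor <;> intros <;> simp <;> ring
    rw [← h.killing k y hy a b]
    have e1 : fderiv ℝ (metricMap G) y (ξ k y) (coordVec a) (coordVec b)
        = ∑ c, ξ k y c * pd c (fun z => G z a b) y := by
      rw [← IsLinearMap.sum_coordVec (T := fun v =>
        fderiv ℝ (metricMap G) y v (coordVec a) (coordVec b)) _ (ξ k y)]
      · simp [fderiv_metricMap hG]
      · constructor <;> intros <;> simp
    have e2 (a c : Fin 4) : pd a (fun z => ξ k z c) y = fderiv ℝ (ξ k) y (coordVec a) c := by
      have := ((EuclideanSpace.proj c : Coord 4 →L[ℝ] ℝ).hasFDerivAt.comp y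
        ((hξ k).differentiableAt (by simp)).hasFDerivAt).fderiv
      have e3 : (⇑(EuclideanSpace.proj c : Coord 4 →L[ℝ] ℝ) ∘ ξ k) = fun z => ξ k z c := rfl
      rw [pd, ← e3, this]
      simp
    rw [e1, metricMap_apply, metricMap_apply, ip, ip]
    simp [coordVec_apply, Finset.sum_add_distrib, e2]
  · have hc := h.commute y hy
    rw [VectorField.lieBracket, sub_eq_zero] at hc
    fin_cases k <;> fin_cases l <;> simp [covAlong, hc, hL.torsion (ξ 0 y)]

/-! ### Linear algebra of two orthogonal nondegenerate planes -/

section Pairs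

variable {B : Coord 4 →L[ℝ] Coord 4 →L[ℝ] ℝ}

/-- Gram matrix of a pair of vectors. -/
def pairGram (B : Coord 4 →L[ℝ] Coord 4 →L[ℝ] ℝ) (p : Fin 2 → Coord 4) :
    Matrix (Fin 2) (Fin 2) ℝ :=
  Matrix.of fun k l => B (p k) (p l)

/-- The planes spanned by `p` and by `q` are nondegenerate and orthogonal to each other. -/
structure IsOrthogonalPair (B : Coord 4 →L[ℝ] Coord 4 →L[ℝ] ℝ) (p q : Fin 2 → Coord 4) :
    Prop where
  symm : ∀ u v, B u v = B v u
  orth : ∀ k i, B (p k) (q i) = 0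
  left : (pairGram B p).det ≠ 0
  right : (pairGram B q).det ≠ 0

theorem IsOrthogonalPair.swap {p q : Fin 2 → Coord 4} (h : IsOrthogonalPair B p q) :
    IsOrthogonalPair B q p :=
  ⟨h.symm, fun k i => by rw [h.symm, h.orth], h.right, h.left⟩

theorem eq_zero_of_pairGram {p : Fin 2 → Coord 4} (h : (pairGram B p).det ≠ 0) {a : Fin 2 → ℝ}
    (ha : ∀ l, B (∑ k, a k • p k) (p l) = 0) : a = 0 := by
  refine Matrix.eq_zero_of_vecMul_eq_zero h ?_
  funext l
  simpa [Matrix.vecMul, dotProduct, pairGram, Fin.sum_univ_two] using ha l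

theorem linearIndependent_of_pairGram {p : Fin 2 → Coord 4} (h : (pairGram B p).det ≠ 0) :
    LinearIndependent ℝ p := by
  rw [Fintype.linearIndependent_iff]
  intro a ha k
  rw [eq_zero_of_pairGram h (a := a) (fun l => by rw [ha]; simp)]
  rfl

/-- Only the plane of `p` has to be nondegenerate: this version is needed before the metric of a
leaf is known to be so. -/
theorem linearIndependent_sumElim {p q : Fin 2 → Coord 4} (hB : ∀ u v, B u v = B v u)
    (hpq : ∀ k i, B (p k) (q i) = 0) (hp : (pairGram B p).det ≠ 0)
    (hq : LinearIndependent ℝ q) : LinearIndependent ℝ (Sum.elim p q) := by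
  rw [Fintype.linearIndependent_iff]
  intro a ha
  simp only [Fintype.sum_sum_type, Sum.elim_inl, Sum.elim_inr] at ha
  have h1 : (fun k => a (Sum.inl k)) = 0 := by
    refine eq_zero_of_pairGram hp fun l => ?_
    have h2 := congrArg (fun v => B v (p l)) ha
    simpa [hB _ (p l), hpq] using h2
  have h3 (k) : a (Sum.inl k) = 0 := congrFun h1 k
  simp only [h3, zero_smul, Finset.sum_const_zero, zero_add] at ha
  rintro (k | i)
  · exact h3 k
  · exact Fintype.linearIndependent_iff.1 hq _ ha i

theorem IsOrthogonalPair.span_eq_top {p q : Fin 2 → Coord 4} (h : IsOrthogonalPair B p q) :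
    Submodule.span ℝ (Set.range (Sum.elim p q)) = ⊤ :=
  (linearIndependent_sumElim h.symm h.orth h.left
    (linearIndependent_of_pairGram h.right)).span_eq_top_of_card_eq_finrank (by simp)

/-- A vector is determined by its products with the vectors of the two planes. -/
theorem IsOrthogonalPair.ext {p q : Fin 2 → Coord 4} (h : IsOrthogonalPair B p q) {v w : Coord 4}
    (hp : ∀ k, B v (p k) = B w (p k)) (hq : ∀ i, B v (q i) = B w (q i)) : v = w := by
  have hs : v - w ∈ Submodule.span ℝ (Set.range (Sum.elim p q)) := by
    rw [h.span_eq_top]; trivial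
  obtain ⟨c, hc⟩ := (Submodule.mem_span_range_iff_exists_fun ℝ).1 hs
  simp only [Fintype.sum_sum_type, Sum.elim_inl, Sum.elim_inr] at hc
  have h1 : (fun k => c (Sum.inl k)) = 0 := by
    refine eq_zero_of_pairGram h.left fun l => ?_
    have h2 := congrArg (fun v => B v (p l)) hc
    have h3 (i) : B (q i) (p l) = 0 := by rw [h.symm, h.orth]
    simpa [h3, hp] using h2
  have h2 : (fun k => c (Sum.inr k)) = 0 := by
    refine eq_zero_of_pairGram h.right fun l => ?_
    have h2 := congrArg (fun v => B v (q l)) hc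
    simpa [h.orth, hq] using h2
  have h3 (k) : c (Sum.inl k) = 0 := congrFun h1 k
  have h4 (k) : c (Sum.inr k) = 0 := congrFun h2 k
  simp only [h3, h4, zero_smul, Finset.sum_const_zero, zero_add] at hc
  exact sub_eq_zero.1 hc.symm

theorem sum_inv_pairGram {p : Fin 2 → Coord 4} (hp : (pairGram B p).det ≠ 0) (f : Fin 2 → ℝ)
    (m : Fin 2) : ∑ k, ∑ l, (pairGram B p)⁻¹ k l * f k * B (p l) (p m) = f m := by
  have h1 := Matrix.nonsing_inv_mul (pairGram B p) (isUnit_iff_ne_zero.2 hp)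
  have h2 (k : Fin 2) : ∑ l, (pairGram B p)⁻¹ k l * f k * B (p l) (p m)
      = f k * (1 : Matrix (Fin 2) (Fin 2) ℝ) k m := by
    rw [← h1, Matrix.mul_apply, Finset.mul_sum]
    exact Finset.sum_congr rfl fun l _ => by simp only [pairGram, Matrix.of_apply]; ring
  simp [h2, Matrix.one_apply]

theorem IsOrthogonalPair.decomp {p q : Fin 2 → Coord 4} (h : IsOrthogonalPair B p q)
    (v : Coord 4) : v = ∑ k, ∑ l, ((pairGram B p)⁻¹ k l * B v (p k)) • p l
      + ∑ k, ∑ l, ((pairGram B q)⁻¹ k l * B v (q k)) • q l := by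
  refine h.ext (fun m => ?_) fun m => ?_
  · rw [← sum_inv_pairGram h.left (fun k => B v (p k)) m]
    simp [h.symm _ (p m), h.orth]
  · rw [← sum_inv_pairGram h.right (fun k => B v (q k)) m]
    simp [h.orth]

/-- Reduces a product of two vectors to their products with the frame; it evaluates `g(∇_u ξ_k, ∇_v
ξ_l)` from the derivatives of `h`. -/
theorem IsOrthogonalPair.metric_eq {p q : Fin 2 → Coord 4} (h : IsOrthogonalPair B p q)
    (v w : Coord 4) : B v w = ∑ k, ∑ l, (pairGram B p)⁻¹ k l * B v (p k) * B w (p l)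
      + ∑ k, ∑ l, (pairGram B q)⁻¹ k l * B v (q k) * B w (q l) := by
  conv_lhs => rw [h.decomp v]
  simp [h.symm w]

/-- The trace does not depend on the basis, so the Ricci contraction may be taken in a frame adapted
to the two planes. -/
theorem IsOrthogonalPair.trace_eq {p q : Fin 2 → Coord 4} (h : IsOrthogonalPair B p q)
    (L : Coord 4 →ₗ[ℝ] Coord 4) : ∑ a, L (coordVec a) a =
      ∑ k, ∑ l, (pairGram B p)⁻¹ k l * B (p k) (L (p l))
      + ∑ k, ∑ l, (pairGram B q)⁻¹ k l * B (q k) (L (q l)) := by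
  have h1 (a : Fin 4) : L (coordVec a) a =
      ∑ k, ∑ l, (pairGram B p)⁻¹ k l * (B (p k) (coordVec a) * L (p l) a)
      + ∑ k, ∑ l, (pairGram B q)⁻¹ k l * (B (q k) (coordVec a) * L (q l) a) := by
    conv_lhs => rw [h.decomp (coordVec a)]
    simp [h.symm (coordVec a), mul_assoc]
  have h2 (u w : Coord 4) : B u w = ∑ a, B u (coordVec a) * w a := by
    rw [← IsLinearMap.sum_coordVec (T := fun w => B u w) _ w]
    · simp [mul_comm]
    · constructor <;> intros <;> simp
  simp only [h1, Finset.sum_add_distrib, h2 _ (L _), Finset.mul_sum]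
  congr 1 <;>
  · rw [Finset.sum_comm]
    exact Finset.sum_congr rfl fun k _ => Finset.sum_comm

/-- The determinant of a bilinear form in a frame consisting of two orthogonal pairs. -/
theorem exists_det_mul_det {G : Matrix (Fin 4) (Fin 4) ℝ} {p q : Fin 2 → Coord 4}
    (hpq : ∀ k i, ip G (p k) (q i) = 0) (hqp : ∀ k i, ip G (q i) (p k) = 0)
    (hli : LinearIndependent ℝ (Sum.elim p q)) :
    ∃ d : ℝ, d ≠ 0 ∧ (Matrix.of fun k l => ip G (p k) (p l)).det
      * (Matrix.of fun k l => ip G (q k) (q l)).det = d ^ 2 * G.det := by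
  let e : Fin 4 ≃ Fin 2 ⊕ Fin 2 := (finSumFinEquiv (m := 2) (n := 2)).symm
  let A : Matrix (Fin 4) (Fin 4) ℝ := Matrix.of fun i a => Sum.elim p q (e i) a
  have hA : A.det ≠ 0 := by
    have h1 : LinearIndependent ℝ A.row := by
      have h2 := (hli.comp e e.injective).map' (WithLp.linearEquiv 2 ℝ (Fin 4 → ℝ)).toLinearMap
        (LinearEquiv.ker _)
      exact h2
    rw [Matrix.linearIndependent_rows_iff_isUnit, Matrix.isUnit_iff_isUnit_det] at h1
    exact h1.ne_zero
  refine ⟨A.det, hA, ?_⟩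
  -- In the frame, the form is the congruent matrix `A G Aᵀ`, and orthogonality makes it block
  -- diagonal; the constant sought is thus `det A`.
  have h3 : (Matrix.fromBlocks (Matrix.of fun k l => ip G (p k) (p l)) 0 0
      (Matrix.of fun k l => ip G (q k) (q l))).submatrix e e = A * G * Aᵀ := by
    have h4 (i j : Fin 4) : (A * G * Aᵀ) i j = ip G (Sum.elim p q (e i)) (Sum.elim p q (e j)) := by
      simp only [Matrix.mul_apply, Matrix.transpose_apply, ip, A, Matrix.of_apply,
        Finset.sum_mul]
      rw [Finset.sum_comm]
      exact Finset.sum_congr rfl fun a _ => Finset.sum_congr rfl fun b _ => by ring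
    ext i j
    rw [h4, Matrix.submatrix_apply]
    rcases e i with k | k <;> rcases e j with l | l <;> simp [hpq, hqp]
  rw [← Matrix.det_fromBlocks_zero₂₁ _ 0, ← Matrix.det_submatrix_equiv_self e, h3,
    Matrix.det_mul, Matrix.det_mul, Matrix.det_transpose]
  ring

end Pairs

/-! ### Algebraic curvature tensors on planes -/

section CurvatureForm

/-- Algebraic curvature tensors. -/
structure IsCurvatureForm (T : Coord 4 → Coord 4 → Coord 4 → Coord 4 → ℝ) : Prop where
  linear : ∀ v w z, IsLinearMap ℝ fun u => T u v w z
  antisymm : ∀ u v w z, T u v w z = -T v u w z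
  pair_symm : ∀ u v w z, T u v w z = T w z u v
  bianchi : ∀ u v w z, T u v w z + T u w z v + T u z v w = 0

variable {T : Coord 4 → Coord 4 → Coord 4 → Coord 4 → ℝ}

theorem IsCurvatureForm.antisymm_right (h : IsCurvatureForm T) (u v w z : Coord 4) :
    T u v w z = -T u v z w := by
  rw [h.pair_symm, h.antisymm, h.pair_symm]

theorem IsCurvatureForm.self_left (h : IsCurvatureForm T) (u w z : Coord 4) :
    T u u w z = 0 := by
  linarith [h.antisymm u u w z]

theorem IsCurvatureForm.self_right (h : IsCurvatureForm T) (u v w : Coord 4) :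
    T u v w w = 0 := by
  rw [h.pair_symm, h.self_left]

theorem IsCurvatureForm.linear₂ (h : IsCurvatureForm T) (u w z : Coord 4) :
    IsLinearMap ℝ fun v => T u v w z := by
  have h1 := h.linear u w z
  constructor <;> intros <;> simp only [h.antisymm u, h1.map_add, h1.map_smul, smul_eq_mul] <;>
    ring

theorem IsCurvatureForm.linear₃ (h : IsCurvatureForm T) (u v z : Coord 4) :
    IsLinearMap ℝ fun w => T u v w z := by
  simpa only [h.pair_symm u v] using h.linear z u v

theorem IsCurvatureForm.linear₄ (h : IsCurvatureForm T) (u v w : Coord 4) :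
    IsLinearMap ℝ fun z => T u v w z := by
  simpa only [h.pair_symm u v] using h.linear₂ w u v

/-- An alternating form on a plane is a multiple of the area form, so a change of vectors in the
plane costs a `2 × 2` determinant. -/
theorem IsCurvatureForm.plane_left (h : IsCurvatureForm T) (p : Fin 2 → Coord 4) (a b : Fin 2 → ℝ)
    (w z : Coord 4) : T (∑ k, a k • p k) (∑ k, b k • p k) w z
      = (a 0 * b 1 - a 1 * b 0) * T (p 0) (p 1) w z := by
  have h1 (v) := (h.linear v w z).map_add
  have h2 (v c u) := (h.linear v w z).map_smul c u
  have h3 (v) := (h.linear₂ v w z).map_add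
  have h4 (v c u) := (h.linear₂ v w z).map_smul c u
  simp only [Fin.sum_univ_two, h1, h2, h3, h4, h.self_left, h.antisymm (p 1) (p 0), smul_eq_mul]
  ring

theorem IsCurvatureForm.plane_right (h : IsCurvatureForm T) (p : Fin 2 → Coord 4) (a b : Fin 2 → ℝ)
    (u v : Coord 4) : T u v (∑ k, a k • p k) (∑ k, b k • p k)
      = (a 0 * b 1 - a 1 * b 0) * T u v (p 0) (p 1) := by
  rw [h.pair_symm, h.plane_left, h.pair_symm u v]

variable {B : Coord 4 →L[ℝ] Coord 4 →L[ℝ] ℝ}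

theorem inv_pairGram_apply (p : Fin 2 → Coord 4) :
    (pairGram B p)⁻¹ 0 0 = B (p 1) (p 1) / (pairGram B p).det ∧
    (pairGram B p)⁻¹ 0 1 = -B (p 0) (p 1) / (pairGram B p).det ∧
    (pairGram B p)⁻¹ 1 0 = -B (p 1) (p 0) / (pairGram B p).det ∧
    (pairGram B p)⁻¹ 1 1 = B (p 0) (p 0) / (pairGram B p).det := by
  rw [Matrix.inv_def, Matrix.adjugate_fin_two]
  simp [pairGram, div_eq_inv_mul]

/-- For an Einstein tensor, complementary orthogonal planes have equal sectional curvatures. -/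
theorem IsCurvatureForm.einstein_planes (h : IsCurvatureForm T) {p q : Fin 2 → Coord 4}
    (hpq : IsOrthogonalPair B p q) {c : ℝ}
    (hp : ∀ v w, ∑ k, ∑ l, (pairGram B p)⁻¹ k l * T (p k) v (p l) w
      + ∑ k, ∑ l, (pairGram B q)⁻¹ k l * T (q k) v (q l) w = c * B v w) :
    T (p 0) (p 1) (p 0) (p 1) / (pairGram B p).det
      = T (q 0) (q 1) (q 0) (q 1) / (pairGram B q).det := by
  obtain ⟨p00, p01, p10, p11⟩ := inv_pairGram_apply (B := B) p
  obtain ⟨q00, q01, q10, q11⟩ := inv_pairGram_apply (B := B) q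
  have hP := hpq.left
  have hQ := hpq.right
  have dP : (pairGram B p).det = B (p 0) (p 0) * B (p 1) (p 1) - B (p 0) (p 1) * B (p 0) (p 1) := by
    rw [Matrix.det_fin_two]; simp [pairGram, hpq.symm (p 1) (p 0)]
  have dQ : (pairGram B q).det = B (q 0) (q 0) * B (q 1) (q 1) - B (q 0) (q 1) * B (q 0) (q 1) := by
    rw [Matrix.det_fin_two]; simp [pairGram, hpq.symm (q 1) (q 0)]
  have e (i j k l : Fin 2) : T (q i) (p k) (q j) (p l) = T (p k) (q i) (p l) (q j) := by
    rw [h.antisymm, h.antisymm_right]; ring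
  have a1 (r : Fin 2 → Coord 4) (w z) : T (r 1) (r 0) w z = -T (r 0) (r 1) w z := h.antisymm _ _ _ _
  have a2 (r : Fin 2 → Coord 4) (w z) : T w z (r 1) (r 0) = -T w z (r 0) (r 1) :=
    h.antisymm_right _ _ _ _
  simp only [Fin.sum_univ_two, p00, p01, p10, p11, q00, q01, q10, q11, hpq.symm (p 1) (p 0),
    hpq.symm (q 1) (q 0)] at hp
  generalize (pairGram B p).det = x at *
  generalize (pairGram B q).det = y at *
  have P00 := hp (p 0) (p 0)
  have P01 := hp (p 0) (p 1)
  have P10 := hp (p 1) (p 0)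
  have P11 := hp (p 1) (p 1)
  have Q00 := hp (q 0) (q 0)
  have Q01 := hp (q 0) (q 1)
  have Q10 := hp (q 1) (q 0)
  have Q11 := hp (q 1) (q 1)
  clear hp p00 p01 p10 p11 q00 q01 q10 q11
  simp only [h.self_left, h.self_right, a1, a2, e, hpq.symm (p 1) (p 0),
    hpq.symm (q 1) (q 0)] at P00 P01 P10 P11 Q00 Q01 Q10 Q11
  generalize B (p 0) (p 0) = A0 at *
  generalize B (p 0) (p 1) = A1 at *
  generalize B (p 1) (p 1) = A2 at *
  generalize B (q 0) (q 0) = C0 at *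
  generalize B (q 0) (q 1) = C1 at *
  generalize B (q 1) (q 1) = C2 at *
  have hx : x * x⁻¹ = 1 := mul_inv_cancel₀ hP
  have hy : y * y⁻¹ = 1 := mul_inv_cancel₀ hQ
  simp only [div_eq_mul_inv] at *
  generalize x⁻¹ = u at *
  generalize y⁻¹ = w at *
  subst dP dQ
  -- The trace of the Einstein equation over one plane is twice its sectional curvature plus a mixed
  -- sum, and equals `2c`. The mixed sum is the same for both planes, so half the difference of the
  -- two traces is the claim; `hx` and `hy` remove the inverses.
  linear_combination (1 / 2 * u) * (A2 * P00 - A1 * P01 - A1 * P10 + A0 * P11)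
    - (1 / 2 * w) * (C2 * Q00 - C1 * Q01 - C1 * Q10 + C0 * Q11)
    + (c - T (p 0) (p 1) (p 0) (p 1) * u) * hx - (c - T (q 0) (q 1) (q 0) (q 1) * w) * hy

end CurvatureForm

/-! ### Riemann, Ricci and Weyl tensors as multilinear forms -/

section Forms

/-- The curvature tensor `R_{abcd}` as a quadrilinear form. -/
def curvForm (G : Coord 4 → Matrix (Fin 4) (Fin 4) ℝ) (y u v w z : Coord 4) : ℝ :=
  metricMap G y u (curv (christoffelMap G) y w z v)

/-- The Ricci tensor as a bilinear form. -/
def ricForm (G : Coord 4 → Matrix (Fin 4) (Fin 4) ℝ) (y v w : Coord 4) : ℝ :=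
  ∑ a, curv (christoffelMap G) y (coordVec a) w v a

/-- The Weyl tensor as a quadrilinear form. -/
def weylForm (G : Coord 4 → Matrix (Fin 4) (Fin 4) ℝ) (y u v w z : Coord 4) : ℝ :=
  curvForm G y u v w z
    - (1 / 2) * (metricMap G y u w * ricForm G y z v - metricMap G y u z * ricForm G y w v)
    + (1 / 2) * (metricMap G y v w * ricForm G y z u - metricMap G y v z * ricForm G y w u)
    + scalarCurv G y / 3 * ((1 / 2) * (metricMap G y u w * metricMap G y z v
      - metricMap G y u z * metricMap G y w v))

theorem quadrilinear_sum {T : Coord 4 → Coord 4 → Coord 4 → Coord 4 → ℝ}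
    (h1 : ∀ v w z, IsLinearMap ℝ fun u => T u v w z)
    (h2 : ∀ u w z, IsLinearMap ℝ fun v => T u v w z)
    (h3 : ∀ u v z, IsLinearMap ℝ fun w => T u v w z)
    (h4 : ∀ u v w, IsLinearMap ℝ fun z => T u v w z) (u v w z : Coord 4) :
    ∑ a, ∑ b, ∑ c, ∑ d, T (coordVec a) (coordVec b) (coordVec c) (coordVec d)
      * u a * v b * w c * z d = T u v w z := by
  rw [← IsLinearMap.sum_coordVec (h1 v w z) u]
  refine Finset.sum_congr rfl fun a _ => ?_
  rw [← IsLinearMap.sum_coordVec (h2 _ w z) v, Finset.smul_sum]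
  refine Finset.sum_congr rfl fun b _ => ?_
  rw [← IsLinearMap.sum_coordVec (h3 _ _ z) w, Finset.smul_sum, Finset.smul_sum]
  refine Finset.sum_congr rfl fun c _ => ?_
  rw [← IsLinearMap.sum_coordVec (h4 _ _ _) z, Finset.smul_sum, Finset.smul_sum, Finset.smul_sum]
  refine Finset.sum_congr rfl fun d _ => ?_
  simp only [smul_eq_mul]
  ring

theorem isLinearMap_curv {E : Type*} [NormedAddCommGroup E] [NormedSpace ℝ E]
    (Γ : E → E →L[ℝ] E →L[ℝ] E) (y v w : E) : IsLinearMap ℝ fun u => curv Γ y u v w := by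
  refine ⟨fun _ _ => ?_, fun _ _ => by simp [curv, smul_sub]⟩
  simp [curv]
  abel

theorem isLinearMap_curv₂ {E : Type*} [NormedAddCommGroup E] [NormedSpace ℝ E]
    (Γ : E → E →L[ℝ] E →L[ℝ] E) (y u w : E) : IsLinearMap ℝ fun v => curv Γ y u v w := by
  refine ⟨fun _ _ => ?_, fun _ _ => by simp [curv, smul_sub]⟩
  simp [curv]
  abel

theorem isLinearMap_curv₃ {E : Type*} [NormedAddCommGroup E] [NormedSpace ℝ E]
    (Γ : E → E →L[ℝ] E →L[ℝ] E) (y u v : E) : IsLinearMap ℝ fun w => curv Γ y u v w := by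
  refine ⟨fun _ _ => ?_, fun _ _ => by simp [curv, smul_sub]⟩
  simp [curv]
  abel

variable {G : Coord 4 → Matrix (Fin 4) (Fin 4) ℝ} {y : Coord 4}

theorem isLinearMap_ricForm (w : Coord 4) : IsLinearMap ℝ fun v => ricForm G y v w := by
  have h1 (a) := (isLinearMap_curv₃ (christoffelMap G) y (coordVec a) w).map_add
  have h2 (a) := (isLinearMap_curv₃ (christoffelMap G) y (coordVec a) w).map_smul
  constructor <;> intros <;> simp [ricForm, h1, h2, Finset.sum_add_distrib, Finset.mul_sum]

theorem isLinearMap_ricForm₂ (v : Coord 4) : IsLinearMap ℝ fun w => ricForm G y v w := by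
  have h1 (a) := (isLinearMap_curv₂ (christoffelMap G) y (coordVec a) v).map_add
  have h2 (a) := (isLinearMap_curv₂ (christoffelMap G) y (coordVec a) v).map_smul
  constructor <;> intros <;> simp [ricForm, h1, h2, Finset.sum_add_distrib, Finset.mul_sum]

theorem ricci_eq_ricForm (hG : ∀ a b, ContDiffAt ℝ ∞ (fun z => G z a b) y)
    (h0 : (G y).det ≠ 0) (b d : Fin 4) :
    ricci G y b d = ricForm G y (coordVec b) (coordVec d) := by
  simp [ricci, ricForm, riemannUp_eq_curv hG h0]

theorem ricForm_eq {p q : Fin 2 → Coord 4} (h : IsOrthogonalPair (metricMap G y) p q)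
    (v w : Coord 4) : ricForm G y v w =
      ∑ k, ∑ l, (pairGram (metricMap G y) p)⁻¹ k l * curvForm G y (p k) v (p l) w
      + ∑ k, ∑ l, (pairGram (metricMap G y) q)⁻¹ k l * curvForm G y (q k) v (q l) w :=
  h.trace_eq ((isLinearMap_curv (christoffelMap G) y w v).mk' _)

/-- Pair symmetry of the curvature, contracted with a symmetric inverse Gram matrix. -/
theorem ricForm_symm {p q : Fin 2 → Coord 4} (h : IsOrthogonalPair (metricMap G y) p q)
    (hT : IsCurvatureForm (curvForm G y)) (v w : Coord 4) :
    ricForm G y v w = ricForm G y w v := by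
  have hs (p : Fin 2 → Coord 4) (k l : Fin 2) :
      (pairGram (metricMap G y) p)⁻¹ k l = (pairGram (metricMap G y) p)⁻¹ l k := by
    have h1 : (pairGram (metricMap G y) p).IsSymm := by
      ext i j; simp [pairGram, h.symm (p i)]
    exact (h1.inv).apply l k
  have hsum (p : Fin 2 → Coord 4) :
      ∑ k, ∑ l, (pairGram (metricMap G y) p)⁻¹ k l * curvForm G y (p k) v (p l) w
      = ∑ k, ∑ l, (pairGram (metricMap G y) p)⁻¹ k l * curvForm G y (p k) w (p l) v := by
    rw [Finset.sum_comm]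
    exact Finset.sum_congr rfl fun k _ => Finset.sum_congr rfl fun l _ => by
      rw [hT.pair_symm, hs]
  rw [ricForm_eq h, ricForm_eq h, hsum p, hsum q]

/-- An Einstein metric has `Ric = Λ g`. -/
theorem ricForm_of_vacuum (hG : ∀ a b, ContDiffAt ℝ ∞ (fun z => G z a b) y)
    (h0 : (G y).det ≠ 0) (hs : (G y).IsSymm) {Λ : ℝ} (hv : ∀ a b, ricci G y a b
      - (1 / 2) * scalarCurv G y * G y a b + Λ * G y a b = 0) :
    scalarCurv G y = 4 * Λ ∧ ∀ v w, ricForm G y v w = Λ * metricMap G y v w := by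
  have h1 : ∑ b, ∑ d, (G y)⁻¹ b d * G y b d = 4 := by
    have h2 := Matrix.nonsing_inv_mul (G y) (isUnit_iff_ne_zero.2 h0)
    have h3 (b) : ∑ d, (G y)⁻¹ b d * G y b d = 1 := by
      have := congrFun (congrFun h2 b) b
      rw [Matrix.mul_apply, Matrix.one_apply_eq] at this
      rw [← this]
      exact Finset.sum_congr rfl fun d _ => by rw [hs.apply]
    simp [h3]
  have h2 : scalarCurv G y = (1 / 2 * scalarCurv G y - Λ) * 4 := by
    conv_lhs => rw [scalarCurv]
    -- The dimension 4 enters as the trace of the identity; contracting the field equation gives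
    -- `scalarCurv = 4Λ`.
    rw [← h1, Finset.mul_sum]
    refine Finset.sum_congr rfl fun b _ => ?_
    rw [Finset.mul_sum]
    exact Finset.sum_congr rfl fun d _ => by linear_combination (G y)⁻¹ b d * hv b d
  have h3 : scalarCurv G y = 4 * Λ := by linarith
  refine ⟨h3, fun v w => sub_eq_zero.1 ?_⟩
  refine linear_ext (T := fun v => ricForm G y v w - Λ * metricMap G y v w) ?_ (fun a => ?_) v
  · constructor <;> intros <;>
      simp [(isLinearMap_ricForm _).map_add, (isLinearMap_ricForm _).map_smul] <;> ring
  refine linear_ext (T := fun w => ricForm G y (coordVec a) w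
    - Λ * metricMap G y (coordVec a) w) ?_ (fun b => ?_) w
  · constructor <;> intros <;>
      simp [(isLinearMap_ricForm₂ _).map_add, (isLinearMap_ricForm₂ _).map_smul] <;> ring
  rw [metricMap_coordVec, ← ricci_eq_ricForm hG h0]
  linear_combination hv a b + 1 / 2 * G y a b * h3

theorem sum_weyl (hG : ∀ a b, ContDiffAt ℝ ∞ (fun z => G z a b) y) (h0 : (G y).det ≠ 0)
    (hT : IsCurvatureForm (curvForm G y)) (u v w z : Coord 4) :
    ∑ a, ∑ b, ∑ c, ∑ d, weyl G y a b c d * u a * v b * w c * z d = weylForm G y u v w z := by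
  have h1 := fun v w z => (hT.linear v w z).map_add
  have h2 := fun v w z => (hT.linear v w z).map_smul
  have h3 := fun v w z => (hT.linear₂ v w z).map_add
  have h4 := fun v w z => (hT.linear₂ v w z).map_smul
  have h5 := fun v w z => (hT.linear₃ v w z).map_add
  have h6 := fun v w z => (hT.linear₃ v w z).map_smul
  have h7 := fun v w z => (hT.linear₄ v w z).map_add
  have h8 := fun v w z => (hT.linear₄ v w z).map_smul
  have r1 := fun v => (isLinearMap_ricForm (G := G) (y := y) v).map_add
  have r2 := fun v => (isLinearMap_ricForm (G := G) (y := y) v).map_smul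
  have r3 := fun v => (isLinearMap_ricForm₂ (G := G) (y := y) v).map_add
  have r4 := fun v => (isLinearMap_ricForm₂ (G := G) (y := y) v).map_smul
  rw [← quadrilinear_sum (T := weylForm G y)]
  · refine Finset.sum_congr rfl fun a _ => Finset.sum_congr rfl fun b _ =>
      Finset.sum_congr rfl fun c _ => Finset.sum_congr rfl fun d _ => ?_
    simp only [weyl, weylForm, curvForm, metricMap_coordVec, riemann_eq_curv hG h0,
      ricci_eq_ricForm hG h0]
  all_goals
    intros
    constructor <;> intros <;>
      simp only [weylForm, h1, h2, h3, h4, h5, h6, h7, h8, r1, r2, r3, r4, map_add, map_smul,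
        add_apply, smul_apply, smul_eq_mul] <;> ring

/-- With `m = a + i b`, the product `m ⊗ m̄` has real part `a ⊗ a + b ⊗ b`. -/
theorem psi2_re (k l : Coord 4) (m : Fin 4 → ℂ) : (psi2 G y k l m).re =
    ∑ a, ∑ b, ∑ c, ∑ d, weyl G y a b c d * k a * reV m b * reV m c * l d
    + ∑ a, ∑ b, ∑ c, ∑ d, weyl G y a b c d * k a * imV m b * imV m c * l d := by
  simp only [psi2, Complex.re_sum, ← Finset.sum_add_distrib]
  refine Finset.sum_congr rfl fun a _ => Finset.sum_congr rfl fun b _ =>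
    Finset.sum_congr rfl fun c _ => Finset.sum_congr rfl fun d _ => ?_
  simp [toC, reV, imV]
  ring

theorem psi2_im (k l : Coord 4) (m : Fin 4 → ℂ) : (psi2 G y k l m).im =
    ∑ a, ∑ b, ∑ c, ∑ d, weyl G y a b c d * k a * imV m b * reV m c * l d
    - ∑ a, ∑ b, ∑ c, ∑ d, weyl G y a b c d * k a * reV m b * imV m c * l d := by
  simp only [psi2, Complex.im_sum, ← Finset.sum_sub_distrib]
  refine Finset.sum_congr rfl fun a _ => Finset.sum_congr rfl fun b _ =>
    Finset.sum_congr rfl fun c _ => Finset.sum_congr rfl fun d _ => ?_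
  simp [toC, reV, imV]
  ring

theorem ipC_re (A : Matrix (Fin 4) (Fin 4) ℝ) (u v : Fin 4 → ℂ) :
    (ipC A u v).re = ip A (reV u) (reV v) - ip A (imV u) (imV v) := by
  simp only [ipC, ip, Complex.re_sum, ← Finset.sum_sub_distrib]
  refine Finset.sum_congr rfl fun a _ => Finset.sum_congr rfl fun b _ => ?_
  simp [reV, imV]

theorem ipC_im (A : Matrix (Fin 4) (Fin 4) ℝ) (u v : Fin 4 → ℂ) :
    (ipC A u v).im = ip A (reV u) (imV v) + ip A (imV u) (reV v) := by
  simp only [ipC, ip, Complex.im_sum, ← Finset.sum_add_distrib]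
  refine Finset.sum_congr rfl fun a _ => Finset.sum_congr rfl fun b _ => ?_
  simp [reV, imV]

end Forms

/-! ### Null tetrads in real form and `Ψ₂` as a curvature component -/

section Tetrads

/-- Real form of a null tetrad `(k, l, m, m̄)` with `m = a + i b`; `ε` is the sign of `m·m̄`. -/
structure IsRealTetrad (B : Coord 4 →L[ℝ] Coord 4 →L[ℝ] ℝ) (ε : ℝ) (k l a b : Coord 4) :
    Prop where
  sq : ε ^ 2 = 1
  kk : B k k = 0
  ll : B l l = 0
  kl : B k l = -ε
  aa : B a a = ε / 2
  bb : B b b = ε / 2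
  ab : B a b = 0
  ka : B k a = 0
  kb : B k b = 0
  la : B l a = 0
  lb : B l b = 0

variable {G : Coord 4 → Matrix (Fin 4) (Fin 4) ℝ} {y : Coord 4}

/-- The sign `ε` treats the two signature conventions at once: `m·m = 0` means that `a` and `b` are
orthogonal with equal squares, and `m·m̄ = ε` makes each square `ε / 2`. -/
theorem isNullTetrad_iff (hB : ∀ u v, metricMap G y u v = metricMap G y v u) (k l : Coord 4)
    (m : Fin 4 → ℂ) : IsNullTetrad (G y) k l m ↔
      ∃ ε, IsRealTetrad (metricMap G y) ε k l (reV m) (imV m) := by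
  have hre (u : Coord 4) : reV (toC u) = u := by ext i; simp [reV, toC]
  have him (u : Coord 4) : imV (toC u) = 0 := by ext i; simp [imV, toC]
  have hrc : reV (fun a => conj (m a)) = reV m := by ext i; simp [reV]
  have hic : imV (fun a => conj (m a)) = -imV m := by ext i; simp [imV]
  have e (A : Matrix (Fin 4) (Fin 4) ℝ) (u v : Fin 4 → ℂ) (x : ℝ) : ipC A u v = (x : ℂ) ↔
      ip A (reV u) (reV v) - ip A (imV u) (imV v) = x
        ∧ ip A (reV u) (imV v) + ip A (imV u) (reV v) = 0 := by
    rw [Complex.ext_iff, ipC_re, ipC_im, Complex.ofReal_re, Complex.ofReal_im]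
  have e0 := fun A u v => e A u v 0
  have e1 := fun A u v => e A u v 1
  have e2 := fun A u v => e A u v (-1)
  push_cast at e0 e1 e2
  constructor
  · rintro ⟨h1, h2, h3, h4, h5, h6⟩
    simp only [e0, e1, e2, hre, him, hrc, hic, ← metricMap_apply, map_zero, zero_apply, map_neg,
      sub_zero, add_zero] at h1 h2 h3 h4 h5 h6
    have h7 := hB (imV m) (reV m)
    rcases h6 with ⟨h6, h8, -⟩ | ⟨h6, h8, -⟩
    · exact ⟨1, by norm_num, h1, h2, h6, by linarith [h3.1], by linarith [h3.1],
        by linarith [h3.2], h4.1, h4.2, h5.1, h5.2⟩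
    · exact ⟨-1, by norm_num, h1, h2, by linarith, by linarith [h3.1], by linarith [h3.1],
        by linarith [h3.2], h4.1, h4.2, h5.1, h5.2⟩
  · rintro ⟨ε, h⟩
    have hε : ε = 1 ∨ ε = -1 := sq_eq_one_iff.1 h.sq
    have h7 := hB (imV m) (reV m)
    constructor <;>
      simp only [e0, e1, e2, hre, him, hrc, hic, ← metricMap_apply, map_zero, zero_apply, map_neg,
        sub_zero, add_zero, h.kk, h.ll, h.ka, h.kb, h.la, h.lb, h.aa, h.bb, h.ab, h.kl, h7]
    · simp
    · simp
    · simp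
    · rcases hε with rfl | rfl <;> norm_num

variable {ε : ℝ} {k l : Coord 4} {m : Fin 4 → ℂ}

theorem IsRealTetrad.isOrthogonalPair {B : Coord 4 →L[ℝ] Coord 4 →L[ℝ] ℝ} {a b : Coord 4}
    (h : IsRealTetrad B ε k l a b) (hB : ∀ u v, B u v = B v u) :
    IsOrthogonalPair B ![k, l] ![a, b] := by
  have hε : ε ≠ 0 := by rintro rfl; simpa using h.sq
  refine ⟨hB, ?_, ?_, ?_⟩
  · intro i j
    fin_cases i <;> fin_cases j <;> simp [h.ka, h.kb, h.la, h.lb]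
  · simp [Matrix.det_fin_two, pairGram, h.kk, h.kl, hB l k, hε]
  · simp [Matrix.det_fin_two, pairGram, h.aa, h.bb, h.ab, hB b a, hε]

/-- In the antisymmetrization over `a` and `b` the only surviving Ricci term, `g(k,l) Ric(a,b)`,
cancels by symmetry, and the scalar term vanishes as `g(a,b) = 0`. The Bianchi identity merges the
two Riemann terms. No field equation enters. -/
theorem psi2_im_eq (hG : ∀ a b, ContDiffAt ℝ ∞ (fun z => G z a b) y) (h0 : (G y).det ≠ 0)
    (hT : IsCurvatureForm (curvForm G y)) (hB : ∀ u v, metricMap G y u v = metricMap G y v u)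
    (h : IsRealTetrad (metricMap G y) ε k l (reV m) (imV m)) :
    (psi2 G y k l m).im = curvForm G y k l (reV m) (imV m) := by
  rw [psi2_im, sum_weyl hG h0 hT, sum_weyl hG h0 hT, weylForm, weylForm,
    hB (imV m) (reV m), ricForm_symm (h.isOrthogonalPair hB) hT (imV m) (reV m),
    h.ka, h.kb, hB (imV m) l, hB (reV m) l, h.la, h.lb, h.ab]
  have b1 := hT.bianchi k (imV m) (reV m) l
  rw [hT.antisymm_right k (reV m), hT.antisymm_right k l (imV m)] at b1
  linear_combination b1

/-- The component `Ric(k, l) = Λ g(k, l)`, written out in the tetrad, expresses the sum of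
`R(k,a,a,l)` and `R(k,b,b,l)` through `R(k,l,k,l)`. -/
theorem psi2_re_eq (hG : ∀ a b, ContDiffAt ℝ ∞ (fun z => G z a b) y) (h0 : (G y).det ≠ 0)
    (hT : IsCurvatureForm (curvForm G y)) (hB : ∀ u v, metricMap G y u v = metricMap G y v u)
    (h : IsRealTetrad (metricMap G y) ε k l (reV m) (imV m)) {Λ : ℝ}
    (hs : scalarCurv G y = 4 * Λ) (hR : ∀ v w, ricForm G y v w = Λ * metricMap G y v w) :
    (psi2 G y k l m).re = Λ / 6 + curvForm G y k l k l / 2 := by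
  have ho := h.isOrthogonalPair hB
  obtain ⟨p00, p01, p10, p11⟩ := inv_pairGram_apply (B := metricMap G y) ![k, l]
  obtain ⟨q00, q01, q10, q11⟩ := inv_pairGram_apply (B := metricMap G y) ![reV m, imV m]
  have hε : ε ≠ 0 := by rintro rfl; simpa using h.sq
  have r := ricForm_eq ho k l
  simp only [Fin.sum_univ_two, p00, p01, p10, p11, q00, q01, q10, q11] at r
  simp only [Matrix.cons_val_zero, Matrix.cons_val_one, hR, Matrix.det_fin_two, pairGram,
    Matrix.of_apply, h.kk, h.ll, h.kl, hB l k, h.aa, h.bb, h.ab, hB (imV m) (reV m),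
    hT.self_left, hT.self_right, hT.antisymm l k k l, hT.antisymm (reV m) k (reV m),
    hT.antisymm (imV m) k (imV m)] at r
  rw [psi2_re, sum_weyl hG h0 hT, sum_weyl hG h0 hT, weylForm, weylForm, hs]
  simp only [hR, h.ka, h.kb, h.aa, h.bb, h.kl, hB (imV m) l, hB (reV m) l, hB (imV m) k,
    hB (reV m) k, hB l k, h.la, h.lb]
  field_simp at r
  ring_nf at r
  refine mul_left_cancel₀ (pow_ne_zero 3 hε) ?_
  linear_combination (-1 / 2) * r + (1 / 6) * Λ * ε ^ 3 * h.sq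

end Tetrads

/-! ### Adapted tetrads and area factors -/

section Planes

variable {B : Coord 4 →L[ℝ] Coord 4 →L[ℝ] ℝ}

theorem bilin_plane (hB : ∀ u v, B u v = B v u) (p : Fin 2 → Coord 4) (a b : Fin 2 → ℝ) :
    B (∑ k, a k • p k) (∑ k, b k • p k) = a 0 * b 0 * B (p 0) (p 0)
      + (a 0 * b 1 + a 1 * b 0) * B (p 0) (p 1) + a 1 * b 1 * B (p 1) (p 1) := by
  simp only [Fin.sum_univ_two, map_add, map_smul, add_apply, smul_apply, smul_eq_mul,
    hB (p 1) (p 0)]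
  ring

theorem det_pairGram (hB : ∀ u v, B u v = B v u) (p : Fin 2 → Coord 4) :
    (pairGram B p).det = B (p 0) (p 0) * B (p 1) (p 1) - B (p 0) (p 1) ^ 2 := by
  simp only [Matrix.det_fin_two, pairGram, Matrix.of_apply, hB (p 1) (p 0)]
  ring

theorem gram_plane (hB : ∀ u v, B u v = B v u) (p : Fin 2 → Coord 4) {u v : Coord 4}
    {a b : Fin 2 → ℝ} (hu : u = ∑ k, a k • p k) (hv : v = ∑ k, b k • p k) :
    B u u * B v v - B u v ^ 2 = (a 0 * b 1 - a 1 * b 0) ^ 2 * (pairGram B p).det := by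
  rw [hu, hv, bilin_plane hB, bilin_plane hB, bilin_plane hB, det_pairGram hB]
  ring

/-- Identifies the orthogonal complement of the Killing plane with the tangent plane of the leaf. -/
theorem IsOrthogonalPair.exists_of_orth {p q : Fin 2 → Coord 4} (h : IsOrthogonalPair B p q)
    {v : Coord 4} (hv : ∀ k, B (p k) v = 0) : ∃ b : Fin 2 → ℝ, v = ∑ k, b k • q k := by
  refine ⟨fun l => ∑ k, (pairGram B q)⁻¹ k l * B v (q k), ?_⟩
  conv_lhs => rw [h.decomp v]
  simp only [h.symm v (p _), hv, mul_zero, zero_smul, Finset.sum_const_zero, zero_add,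
    Finset.sum_smul]
  exact Finset.sum_comm

variable {T : Coord 4 → Coord 4 → Coord 4 → Coord 4 → ℝ}

/-- Curvature components in a tetrad adapted to two orthogonal planes. -/
theorem IsCurvatureForm.tetrad (hT : IsCurvatureForm T) {p q : Fin 2 → Coord 4}
    (h : IsOrthogonalPair B p q) {ε : ℝ} {k l u v : Coord 4} (ht : IsRealTetrad B ε k l u v)
    {α β γ δ : Fin 2 → ℝ} (hk : k = ∑ i, α i • p i) (hl : l = ∑ i, β i • p i)
    (hu : u = ∑ i, γ i • q i) (hv : v = ∑ i, δ i • q i) :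
    T k l u v ^ 2 = -T (p 0) (p 1) (q 0) (q 1) ^ 2
      / (4 * ((pairGram B p).det * (pairGram B q).det)) ∧
    T k l k l = -T (p 0) (p 1) (p 0) (p 1) / (pairGram B p).det := by
  have h1 := gram_plane h.symm p hk hl
  have h2 := gram_plane h.symm q hu hv
  rw [ht.kk, ht.ll, ht.kl] at h1
  rw [ht.aa, ht.bb, ht.ab] at h2
  have hP := h.left
  have hQ := h.right
  have h3 : T k l u v = (α 0 * β 1 - α 1 * β 0) * (γ 0 * δ 1 - γ 1 * δ 0)
      * T (p 0) (p 1) (q 0) (q 1) := by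
    rw [hk, hl, hu, hv, hT.plane_left, hT.plane_right]; ring
  have h4 : T k l k l = (α 0 * β 1 - α 1 * β 0) ^ 2 * T (p 0) (p 1) (p 0) (p 1) := by
    rw [hk, hl, hT.plane_left, hT.plane_right]; ring
  rw [h3, h4]
  generalize α 0 * β 1 - α 1 * β 0 = D at *
  generalize γ 0 * δ 1 - γ 1 * δ 0 = E at *
  generalize (pairGram B p).det = x at *
  generalize (pairGram B q).det = y at *
  -- The Gram determinants of `(k, l)` and `(a, b)` are `-ε² = -1` and `ε² / 4 = 1/4`; they
  -- determine the squares of the area factors `D` and `E`.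
  have hD : D ^ 2 * x = -1 := by linear_combination -h1 - ht.sq
  have hE : E ^ 2 * y = 1 / 4 := by linear_combination -h2 + ht.sq / 4
  constructor
  · rw [eq_div_iff (by positivity)]
    linear_combination (4 * T (p 0) (p 1) (q 0) (q 1) ^ 2) * (E ^ 2 * y * hD - hE)
  · rw [eq_div_iff hP]
    linear_combination T (p 0) (p 1) (p 0) (p 1) * hD

theorem exists_null_pair (hB : ∀ u v, B u v = B v u) {p : Fin 2 → Coord 4}
    (hp : (pairGram B p).det < 0) (ε : ℝ) : ∃ a b : Fin 2 → ℝ,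
      B (∑ k, a k • p k) (∑ k, a k • p k) = 0 ∧ B (∑ k, b k • p k) (∑ k, b k • p k) = 0
      ∧ B (∑ k, a k • p k) (∑ k, b k • p k) = -ε := by
  -- Two null vectors with nonzero product suffice: rescaling one of them gives the product `-ε`.
  suffices ∃ a b : Fin 2 → ℝ, B (∑ k, a k • p k) (∑ k, a k • p k) = 0 ∧
      B (∑ k, b k • p k) (∑ k, b k • p k) = 0 ∧ B (∑ k, a k • p k) (∑ k, b k • p k) ≠ 0 by
    obtain ⟨a, b, ha, hb, hab⟩ := this
    have hc (c : ℝ) : ∑ k, (c • b) k • p k = c • ∑ k, b k • p k := by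
      simp [mul_smul]
    refine ⟨a, (-ε / B (∑ k, a k • p k) (∑ k, b k • p k)) • b, ha, ?_, ?_⟩
    · rw [hc, map_smul, map_smul, smul_apply, hb]
      simp
    · rw [hc, map_smul, smul_eq_mul, div_mul_cancel₀ _ hab]
  rw [det_pairGram hB] at hp
  simp only [bilin_plane hB]
  generalize B (p 0) (p 0) = A at *
  generalize B (p 0) (p 1) = C at *
  generalize B (p 1) (p 1) = D at *
  have hs : Real.sqrt (C ^ 2 - A * D) ^ 2 = C ^ 2 - A * D := Real.sq_sqrt (by linarith)
  have hpos : 0 < Real.sqrt (C ^ 2 - A * D) := Real.sqrt_pos.2 (by linarith)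
  generalize Real.sqrt (C ^ 2 - A * D) = s at *
  -- The null directions are the roots of `A X² + 2 C X Y + D Y²`, real because the discriminant is
  -- positive; if `A = 0`, one of them is `(1, 0)`.
  by_cases hA : A = 0
  · subst hA
    have hC : C ≠ 0 := by rintro rfl; simp at hp
    refine ⟨![1, 0], ![-D, 2 * C], ?_, ?_, ?_⟩ <;> simp
    · ring
    · exact hC
  · refine ⟨![-C + s, A], ![-C - s, A], ?_, ?_, ?_⟩ <;>
      simp only [Matrix.cons_val_zero, Matrix.cons_val_one]
    · linear_combination A * hs
    · linear_combination A * hs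
    · have : (-C + s) * (-C - s) * A + ((-C + s) * A + A * (-C - s)) * C + A * A * D
          = -2 * A * s ^ 2 := by linear_combination A * hs
      rw [this]
      have := hpos.ne'
      positivity

theorem exists_orthonormal_pair (hB : ∀ u v, B u v = B v u) {p : Fin 2 → Coord 4}
    (hp : 0 < (pairGram B p).det) : ∃ (ε : ℝ) (a b : Fin 2 → ℝ), ε ^ 2 = 1 ∧
      B (∑ k, a k • p k) (∑ k, a k • p k) = ε / 2 ∧ B (∑ k, b k • p k) (∑ k, b k • p k) = ε / 2
      ∧ B (∑ k, a k • p k) (∑ k, b k • p k) = 0 := by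
  rw [det_pairGram hB] at hp
  simp only [bilin_plane hB]
  generalize B (p 0) (p 0) = A at *
  generalize B (p 0) (p 1) = C at *
  generalize B (p 1) (p 1) = D at *
  have hA : A ≠ 0 := by rintro rfl; nlinarith [sq_nonneg C]
  have hA' : 0 < |A| := abs_pos.2 hA
  obtain ⟨s, hs⟩ : ∃ s : ℝ, s ^ 2 * (2 * |A|) = 1 :=
    ⟨(Real.sqrt (2 * |A|))⁻¹, by rw [inv_pow, Real.sq_sqrt (by positivity)]; field_simp⟩
  obtain ⟨r, hr⟩ : ∃ r : ℝ, r ^ 2 * (2 * |A| * (A * D - C ^ 2)) = 1 :=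
    ⟨(Real.sqrt (2 * |A| * (A * D - C ^ 2)))⁻¹, by
      rw [inv_pow, Real.sq_sqrt (by positivity)]; field_simp⟩
  obtain ⟨ε, hε, hεA⟩ : ∃ ε : ℝ, ε ^ 2 = 1 ∧ A = ε * |A| := by
    rcases abs_cases A with ⟨h, -⟩ | ⟨h, -⟩
    · exact ⟨1, by norm_num, by rw [h]; ring⟩
    · exact ⟨-1, by norm_num, by rw [h]; ring⟩
  -- Gram–Schmidt: `-C p₀ + A p₁` is orthogonal to `p₀` and has square `A (A D - C²)`. Here `ε` is
  -- the sign of the definite form, and `s`, `r` normalize the squares to `ε / 2`.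
  refine ⟨ε, ![s, 0], ![-C * r, A * r], hε, ?_, ?_, ?_⟩ <;>
    simp only [Matrix.cons_val_zero, Matrix.cons_val_one]
  · linear_combination s ^ 2 * hεA + ε / 2 * hs
  · linear_combination r ^ 2 * (A * D - C ^ 2) * hεA + ε / 2 * hr
  · ring

/-- If exactly one of two orthogonal planes is Lorentzian, there is an adapted null tetrad. -/
theorem IsOrthogonalPair.exists_tetrad {p q : Fin 2 → Coord 4} (h : IsOrthogonalPair B p q)
    (hp : (pairGram B p).det < 0) (hq : 0 < (pairGram B q).det) :
    ∃ (ε : ℝ) (α β γ δ : Fin 2 → ℝ), IsRealTetrad B ε (∑ i, α i • p i) (∑ i, β i • p i)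
      (∑ i, γ i • q i) (∑ i, δ i • q i) := by
  obtain ⟨ε, γ, δ, hε, h1, h2, h3⟩ := exists_orthonormal_pair h.symm hq
  obtain ⟨α, β, h4, h5, h6⟩ := exists_null_pair h.symm hp ε
  have h7 (a b : Fin 2 → ℝ) : B (∑ i, a i • p i) (∑ i, b i • q i) = 0 := by
    simp [Fin.sum_univ_two, h.orth]
  exact ⟨ε, α, β, γ, δ, hε, h4, h5, h6, h1, h2, h3, h7 _ _, h7 _ _, h7 _ _, h7 _ _⟩

theorem IsRealTetrad.neg {ε : ℝ} {k l u v : Coord 4} (h : IsRealTetrad B ε k l u v) :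
    IsRealTetrad B ε k l u (-v) := by
  refine ⟨h.sq, h.kk, h.ll, h.kl, h.aa, ?_, ?_, h.ka, ?_, h.la, ?_⟩ <;>
    simp [h.bb, h.ab, h.kb, h.lb]

end Planes

/-! ### Calculus of vector fields along a map -/

section Along

variable {E F : Type*} [NormedAddCommGroup E] [NormedSpace ℝ E]
  [NormedAddCommGroup F] [NormedSpace ℝ F]
  {Γ : E → E →L[ℝ] E →L[ℝ] E} {g : E → E →L[ℝ] E →L[ℝ] ℝ}

theorem covAlong_congr {f Z W : F → E} {t : F} (h : Z =ᶠ[nhds t] W) (u : F) :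
    covAlong Γ f Z u t = covAlong Γ f W u t := by
  rw [covAlong, covAlong, h.fderiv_eq, h.self_of_nhds]

theorem covAlong_comp {f : F → E} {Z : E → E} {t : F} (hf : DifferentiableAt ℝ f t)
    (hZ : DifferentiableAt ℝ Z (f t)) (u : F) :
    covAlong Γ f (fun s => Z (f s)) u t = covAlong Γ id Z (fderiv ℝ f t u) (f t) := by
  have h : HasFDerivAt (fun s => Z (f s)) ((fderiv ℝ Z (f t)).comp (fderiv ℝ f t)) t :=
    hZ.hasFDerivAt.comp t hf.hasFDerivAt
  simp [covAlong, h.fderiv]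

theorem covAlong_sum_smul {ι : Type*} [Fintype ι] {f : F → E} {c : ι → F → ℝ} {Z : ι → F → E}
    {t : F} (hc : ∀ m, DifferentiableAt ℝ (c m) t) (hZ : ∀ m, DifferentiableAt ℝ (Z m) t)
    (u : F) : covAlong Γ f (fun s => ∑ m, c m s • Z m s) u t
      = ∑ m, (fderiv ℝ (c m) t u • Z m t + c m t • covAlong Γ f (Z m) u t) := by
  have h : HasFDerivAt (fun s => ∑ m, c m s • Z m s) (∑ m, (c m t • fderiv ℝ (Z m) t
      + (fderiv ℝ (c m) t).smulRight (Z m t))) t :=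
    HasFDerivAt.fun_sum fun m _ => (hc m).hasFDerivAt.fun_smul (hZ m).hasFDerivAt
  rw [covAlong, h.fderiv]
  simp only [sum_apply, add_apply, smul_apply, ContinuousLinearMap.smulRight_apply, map_sum,
    map_smul, ← Finset.sum_add_distrib, covAlong, smul_add]
  exact Finset.sum_congr rfl fun m _ => by abel

theorem contDiffAt_metric_along {n : WithTop ℕ∞} {f Y Z : F → E} {t : F}
    (hg : ContDiffAt ℝ n g (f t)) (hf : ContDiffAt ℝ n f t) (hY : ContDiffAt ℝ n Y t)
    (hZ : ContDiffAt ℝ n Z t) : ContDiffAt ℝ n (fun s => g (f s) (Y s) (Z s)) t := by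
  have h : ContDiffAt ℝ n (fun s => g (f s)) t := hg.comp t hf
  exact (h.clm_apply hY).clm_apply hZ

/-- Symmetry of second derivatives together with vanishing torsion; for a leaf, this is the symmetry
of the second fundamental form. -/
theorem covAlong_fderiv_symm {f : F → E} {t : F} (hf : ContDiffAt ℝ 2 f t)
    (hΓ : ∀ u v, Γ (f t) u v = Γ (f t) v u) (u v : F) :
    covAlong Γ f (fun s => fderiv ℝ f s v) u t = covAlong Γ f (fun s => fderiv ℝ f s u) v t := by
  rw [covAlong, covAlong, (hasFDerivAt_fderiv_apply hf v).fderiv,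
    (hasFDerivAt_fderiv_apply hf u).fderiv, hΓ]
  simp [fderiv_fderiv_comm hf u v]

end Along

/-! ### Geometry of the leaves -/

section Leaf

variable {G : Coord 4 → Matrix (Fin 4) (Fin 4) ℝ} {ξ : Fin 2 → Coord 4 → Coord 4}
  {U : Set (Coord 4)} {V : Set (Coord 2)} {σ : Coord 2 → Coord 4}

/-- The coordinate fields of a parametrized surface. -/
def leafFrame (σ : Coord 2 → Coord 4) (s : Coord 2) (i : Fin 2) : Coord 4 :=
  fderiv ℝ σ s (coordVec i)

theorem pairGram_killing (y : Coord 4) :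
    pairGram (metricMap G y) (fun k => ξ k y) = killingGram G ξ y := by
  ext k l; simp [pairGram, killingGram, metricMap_apply]

theorem pairGram_leafFrame (s : Coord 2) :
    pairGram (metricMap G (σ s)) (leafFrame σ s) = leafMetric G σ s := by
  ext k l; simp [pairGram, leafMetric, metricMap_apply, leafFrame]

theorem leafMetric_apply (s : Coord 2) (i j : Fin 2) :
    leafMetric G σ s i j = metricMap G (σ s) (leafFrame σ s i) (leafFrame σ s j) := by
  rw [← pairGram_leafFrame]; rfl

theorem two_le_infty : (2 : WithTop ℕ∞) ≤ ∞ := by norm_cast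

/-- A leaf of an orthogonally transitive Killing pair on the open set `U`. -/
structure IsKillingLeaf (G : Coord 4 → Matrix (Fin 4) (Fin 4) ℝ) (ξ : Fin 2 → Coord 4 → Coord 4)
    (U : Set (Coord 4)) (V : Set (Coord 2)) (σ : Coord 2 → Coord 4) : Prop where
  pair : IsTransitivePairOn G ξ U
  isOpen : IsOpen U
  leaf : IsLeaf G ξ U V σ

variable {s : Coord 2}

theorem IsKillingLeaf.killing (h : IsKillingLeaf G ξ U V σ) (hs : s ∈ V) :
    IsCommutingKillingAt (christoffelMap G) (metricMap G) ξ (σ s) :=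
  h.pair.isCommutingKillingAt h.isOpen (h.leaf.mapsTo hs)

theorem IsKillingLeaf.smooth_components (h : IsKillingLeaf G ξ U V σ) (hs : s ∈ V)
    (a b : Fin 4) : ContDiffAt ℝ ∞ (fun z => G z a b) (σ s) :=
  (h.pair.metric_smooth a b).contDiffAt (h.isOpen.mem_nhds (h.leaf.mapsTo hs))

theorem IsKillingLeaf.smooth_leaf (h : IsKillingLeaf G ξ U V σ) (hs : s ∈ V) :
    ContDiffAt ℝ ∞ σ s :=
  h.leaf.smooth.contDiffAt (h.leaf.isOpen.mem_nhds hs)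

theorem IsKillingLeaf.smooth_field (h : IsKillingLeaf G ξ U V σ) (hs : s ∈ V) (k : Fin 2) :
    ContDiffAt ℝ ∞ (ξ k) (σ s) :=
  (h.pair.field_smooth k).contDiffAt (h.isOpen.mem_nhds (h.leaf.mapsTo hs))

theorem IsKillingLeaf.smooth_frame (h : IsKillingLeaf G ξ U V σ) (hs : s ∈ V) (i : Fin 2) :
    ContDiffAt ℝ ∞ (fun r => leafFrame σ r i) s :=
  ((h.smooth_leaf hs).fderiv_right (m := ∞) (by simp)).clm_apply contDiffAt_const

theorem IsKillingLeaf.differentiableAt_metric (h : IsKillingLeaf G ξ U V σ) (hs : s ∈ V) :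
    DifferentiableAt ℝ (metricMap G) (σ s) :=
  (h.killing hs).smooth_metric.differentiableAt (by norm_num)

theorem IsKillingLeaf.differentiableAt_leaf (h : IsKillingLeaf G ξ U V σ) (hs : s ∈ V) :
    DifferentiableAt ℝ σ s :=
  (h.smooth_leaf hs).differentiableAt (by simp)

theorem IsKillingLeaf.differentiableAt_frame (h : IsKillingLeaf G ξ U V σ) (hs : s ∈ V)
    (i : Fin 2) : DifferentiableAt ℝ (fun r => leafFrame σ r i) s :=
  (h.smooth_frame hs i).differentiableAt (by simp)

theorem IsKillingLeaf.smooth_metric (h : IsKillingLeaf G ξ U V σ) (hs : s ∈ V) (i j : Fin 2) :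
    ContDiffAt ℝ ∞ (fun r => leafMetric G σ r i j) s := by
  simp only [leafMetric_apply]
  exact contDiffAt_metric_along (contDiffAt_metricMap (h.smooth_components hs)) (h.smooth_leaf hs)
    (h.smooth_frame hs i) (h.smooth_frame hs j)

theorem IsKillingLeaf.smooth_gram (h : IsKillingLeaf G ξ U V σ) (hs : s ∈ V) (k l : Fin 2) :
    ContDiffAt ℝ ∞ (fun z => metricMap G z (ξ k z) (ξ l z)) (σ s) :=
  contDiffAt_metric_along (f := id) (contDiffAt_metricMap (h.smooth_components hs)) contDiffAt_id
    (h.smooth_field hs k) (h.smooth_field hs l)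

theorem IsKillingLeaf.orth (h : IsKillingLeaf G ξ U V σ) (hs : s ∈ V) (k i : Fin 2) :
    metricMap G (σ s) (ξ k (σ s)) (leafFrame σ s i) = 0 := by
  rw [metricMap_apply]; exact h.leaf.orthogonal s hs k _

/-- Used first to show that the leaf metric is nondegenerate, later, in the Lorentz case, to see
that `det h` and `det g` have opposite signs. -/
theorem IsKillingLeaf.exists_det (h : IsKillingLeaf G ξ U V σ) (hs : s ∈ V) :
    ∃ d : ℝ, d ≠ 0 ∧ (leafGram G ξ σ s).det * (leafMetric G σ s).det = d ^ 2 * (G (σ s)).det := by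
  have hsymm := (h.killing hs).levi.symm
  have hq : LinearIndependent ℝ (leafFrame σ s) := by
    have h1 := (EuclideanSpace.basisFun (Fin 2) ℝ).toBasis.linearIndependent.map'
      (fderiv ℝ σ s).toLinearMap (LinearMap.ker_eq_bot.2 (h.leaf.immersion s hs))
    have h2 : (fderiv ℝ σ s).toLinearMap ∘ (EuclideanSpace.basisFun (Fin 2) ℝ).toBasis
        = leafFrame σ s := by
      funext i; simp [leafFrame, coordVec]
    rwa [h2] at h1
  refine exists_det_mul_det (p := fun k => ξ k (σ s)) (q := leafFrame σ s) (fun k i => ?_)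
    (fun k i => ?_) (linearIndependent_sumElim hsymm (h.orth hs) ?_ hq)
  · rw [← metricMap_apply]; exact h.orth hs k i
  · rw [← metricMap_apply, hsymm]; exact h.orth hs k i
  · rw [pairGram_killing]; exact h.pair.transversal _ (h.leaf.mapsTo hs)

theorem IsKillingLeaf.isOrthogonalPair (h : IsKillingLeaf G ξ U V σ) (hs : s ∈ V) :
    IsOrthogonalPair (metricMap G (σ s)) (fun k => ξ k (σ s)) (leafFrame σ s) := by
  refine ⟨(h.killing hs).levi.symm, h.orth hs, ?_, ?_⟩
  · rw [pairGram_killing]; exact h.pair.transversal _ (h.leaf.mapsTo hs)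
  · rw [pairGram_leafFrame]
    obtain ⟨d, hd, hd'⟩ := h.exists_det hs
    have := mul_ne_zero (pow_ne_zero 2 hd) (h.pair.metric_nondeg _ (h.leaf.mapsTo hs))
    rw [← hd'] at this
    exact right_ne_zero_of_mul this

theorem IsKillingLeaf.covAlong_frame_symm (h : IsKillingLeaf G ξ U V σ) (hs : s ∈ V)
    (i j : Fin 2) :
    covAlong (christoffelMap G) σ (fun r => leafFrame σ r j) (coordVec i) s
      = covAlong (christoffelMap G) σ (fun r => leafFrame σ r i) (coordVec j) s :=
  covAlong_fderiv_symm ((h.smooth_leaf hs).of_le two_le_infty) (h.killing hs).levi.torsion _ _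

/-- The leaves are totally geodesic. -/
theorem IsKillingLeaf.cov_orth (h : IsKillingLeaf G ξ U V σ) (hs : s ∈ V) (k i j : Fin 2) :
    metricMap G (σ s) (covAlong (christoffelMap G) id (ξ k) (leafFrame σ s i) (σ s))
      (leafFrame σ s j) = 0 ∧
    metricMap G (σ s) (covAlong (christoffelMap G) σ (fun r => leafFrame σ r j) (coordVec i) s)
      (ξ k (σ s)) = 0 := by
  have hK := h.killing hs
  have hξd := (hK.smooth_field k).differentiableAt (by norm_num)
  have key (i j : Fin 2) :
      metricMap G (σ s) (covAlong (christoffelMap G) id (ξ k) (leafFrame σ s i) (σ s))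
        (leafFrame σ s j) + metricMap G (σ s) (covAlong (christoffelMap G) σ
          (fun r => leafFrame σ r j) (coordVec i) s) (ξ k (σ s)) = 0 := by
    have h1 : (fun r => metricMap G (σ r) (ξ k (σ r)) (leafFrame σ r j)) =ᶠ[nhds s]
        fun _ => (0 : ℝ) :=
      Filter.eventually_of_mem (h.leaf.isOpen.mem_nhds hs) fun r hr => h.orth hr k j
    have h2 := fderiv_metric_along (Y := fun r => ξ k (σ r)) hK.levi
      (h.differentiableAt_metric hs) (h.differentiableAt_leaf hs)
      (hξd.comp s (h.differentiableAt_leaf hs)) (h.differentiableAt_frame hs j) (coordVec i)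
    rw [h1.fderiv_eq, covAlong_comp (h.differentiableAt_leaf hs) hξd,
      hK.levi.symm (ξ k (σ s))] at h2
    simpa [leafFrame] using h2.symm
  -- Differentiating `g(ξ_k, e_j) = 0` makes `g(∇_{e_i} ξ_k, e_j)` and `g(∇_{e_i} e_j, ξ_k)`
  -- opposite. The first is antisymmetric in `i, j`, the second symmetric, so both vanish.
  have h1 := key i j
  have h2 := key j i
  have h3 := hK.killing k (leafFrame σ s i) (leafFrame σ s j)
  rw [h.covAlong_frame_symm hs] at h2
  constructor <;> linarith

theorem IsKillingLeaf.pd_metric (h : IsKillingLeaf G ξ U V σ) (hs : s ∈ V) (i j l : Fin 2) :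
    pd i (fun r => leafMetric G σ r j l) s =
      metricMap G (σ s) (covAlong (christoffelMap G) σ (fun r => leafFrame σ r j) (coordVec i) s)
        (leafFrame σ s l)
      + metricMap G (σ s) (covAlong (christoffelMap G) σ (fun r => leafFrame σ r l)
        (coordVec i) s) (leafFrame σ s j) := by
  simp only [leafMetric_apply, pd]
  rw [fderiv_metric_along (h.killing hs).levi (h.differentiableAt_metric hs)
    (h.differentiableAt_leaf hs) (h.differentiableAt_frame hs j) (h.differentiableAt_frame hs l),
    (h.killing hs).levi.symm (leafFrame σ s j)]

theorem IsKillingLeaf.metric_isSymm (h : IsKillingLeaf G ξ U V σ) (hs : s ∈ V) :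
    (leafMetric G σ s).IsSymm := by
  ext i j
  rw [Matrix.transpose_apply, leafMetric_apply, leafMetric_apply, (h.killing hs).levi.symm]

theorem IsKillingLeaf.metric_det (h : IsKillingLeaf G ξ U V σ) (hs : s ∈ V) :
    (leafMetric G σ s).det ≠ 0 := by
  rw [← pairGram_leafFrame]; exact (h.isOrthogonalPair hs).right

/-- The Gauss formula without second fundamental form: the normal part vanishes by `cov_orth`, and
the tangential part is given by the Koszul formula. -/
theorem IsKillingLeaf.covAlong_frame (h : IsKillingLeaf G ξ U V σ) (hs : s ∈ V) (i j : Fin 2) :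
    covAlong (christoffelMap G) σ (fun r => leafFrame σ r j) (coordVec i) s
      = ∑ m, christoffel (leafMetric G σ) m i j s • leafFrame σ s m := by
  refine (h.isOrthogonalPair hs).ext (fun k => ?_) fun l => ?_
  · rw [(h.cov_orth hs k i j).2]
    simp [(h.killing hs).levi.symm (leafFrame σ s _) (ξ k (σ s)), h.orth hs]
  · have h1 := sum_metric_christoffel (h.metric_isSymm hs) (h.metric_det hs) i j l
    rw [h.pd_metric hs, h.pd_metric hs, h.pd_metric hs, h.covAlong_frame_symm hs j i,
      h.covAlong_frame_symm hs l i, h.covAlong_frame_symm hs l j] at h1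
    simp only [map_sum, map_smul, sum_apply, smul_apply, smul_eq_mul]
    simp only [leafMetric_apply, mul_comm] at h1 ⊢
    rw [h1]
    ring

theorem IsKillingLeaf.covAlong_covAlong_frame (h : IsKillingLeaf G ξ U V σ) (hs : s ∈ V)
    (i j k : Fin 2) : covAlong (christoffelMap G) σ (covAlong (christoffelMap G) σ
      (fun r => leafFrame σ r k) (coordVec j)) (coordVec i) s
      = ∑ m, (pd i (christoffel (leafMetric G σ) m j k) s
        + ∑ e, christoffel (leafMetric G σ) m i e s * christoffel (leafMetric G σ) e j k s)
          • leafFrame σ s m := by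
  have hc (m) : DifferentiableAt ℝ (christoffel (leafMetric G σ) m j k) s :=
    (contDiffAt_christoffel (h.smooth_metric hs) (h.metric_det hs) m j k).differentiableAt (by simp)
  have h2 : covAlong (christoffelMap G) σ (fun r => leafFrame σ r k) (coordVec j) =ᶠ[nhds s]
      fun r => ∑ m, christoffel (leafMetric G σ) m j k r • leafFrame σ r m :=
    Filter.eventually_of_mem (h.leaf.isOpen.mem_nhds hs) fun r hr => h.covAlong_frame hr j k
  rw [covAlong_congr h2, covAlong_sum_smul hc (h.differentiableAt_frame hs)]
  simp only [h.covAlong_frame hs, add_smul, Finset.sum_add_distrib, Finset.smul_sum,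
    Finset.sum_smul, smul_smul]
  congr 1
  rw [Finset.sum_comm]
  exact Finset.sum_congr rfl fun m _ => Finset.sum_congr rfl fun e _ => by rw [mul_comm]

/-- The Gauss equation for a totally geodesic surface: the commutator of covariant derivatives along
`σ` is computed once in the ambient space and once in the leaf. -/
theorem IsKillingLeaf.curv_frame (h : IsKillingLeaf G ξ U V σ) (hs : s ∈ V) (i j k : Fin 2) :
    curv (christoffelMap G) (σ s) (leafFrame σ s i) (leafFrame σ s j) (leafFrame σ s k)
      = ∑ m, riemannUp (leafMetric G σ) s m k i j • leafFrame σ s m := by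
  have hf : ContDiffAt ℝ 2 σ s := (h.smooth_leaf hs).of_le two_le_infty
  have hZ : ContDiffAt ℝ 2 (fun r => leafFrame σ r k) s :=
    (h.smooth_frame hs k).of_le two_le_infty
  have h3 := covAlong_comm (f := σ) (Z := fun r => leafFrame σ r k) (t := s)
    (h.killing hs).diff_christoffel hf hZ (coordVec i) (coordVec j)
  have h4 := h.covAlong_covAlong_frame hs i j k
  have h5 := h.covAlong_covAlong_frame hs j i k
  generalize covAlong (christoffelMap G) σ (covAlong (christoffelMap G) σ
      (fun r => leafFrame σ r k) (coordVec j)) (coordVec i) s = X at h3 h4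
  generalize covAlong (christoffelMap G) σ (covAlong (christoffelMap G) σ
      (fun r => leafFrame σ r k) (coordVec i)) (coordVec j) s = Y at h3 h5
  subst h4 h5
  rw [← Finset.sum_sub_distrib] at h3
  refine h3.symm.trans ?_
  refine Finset.sum_congr rfl fun m _ => ?_
  rw [← sub_smul, riemannUp, Finset.sum_sub_distrib]
  congr 1
  ring

theorem IsKillingLeaf.isCurvatureForm (h : IsKillingLeaf G ξ U V σ) (hs : s ∈ V) :
    IsCurvatureForm (curvForm G (σ s)) := by
  have hK := h.killing hs
  have hL : ∀ᶠ z in nhds (σ s), IsLeviCivitaAt (christoffelMap G) (metricMap G) z :=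
    Filter.eventually_of_mem (h.isOpen.mem_nhds (h.leaf.mapsTo hs))
      fun z hz => (h.pair.isCommutingKillingAt h.isOpen hz).levi
  have hsy := hK.levi.symm
  refine ⟨fun v w z => ?_, fun u v w z => ?_, fun u v w z => ?_, fun u v w z => ?_⟩
  · constructor <;> intros <;> simp [curvForm]
  · rw [curvForm, curvForm, hsy, metric_curv_antisymm hL hK.diff_christoffel hK.smooth_metric,
      hsy]
  · rw [curvForm, curvForm, hsy, metric_curv_pair_symm hL hK.diff_christoffel hK.smooth_metric,
      curv_antisymm, map_neg, neg_apply,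
      metric_curv_antisymm hL hK.diff_christoffel hK.smooth_metric, neg_neg, hsy]
  · simp only [curvForm, ← map_add]
    rw [curv_bianchi hL hK.diff_christoffel, map_zero]

/-- The scalar curvature of a leaf. -/
theorem IsKillingLeaf.scalarCurv_eq (h : IsKillingLeaf G ξ U V σ) (hs : s ∈ V) :
    scalarCurv (leafMetric G σ) s = 2 * curvForm G (σ s) (leafFrame σ s 0) (leafFrame σ s 1)
      (leafFrame σ s 0) (leafFrame σ s 1) / (leafMetric G σ s).det := by
  have hT := h.isCurvatureForm hs
  have h1 (l k i j : Fin 2) : curvForm G (σ s) (leafFrame σ s l) (leafFrame σ s k)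
      (leafFrame σ s i) (leafFrame σ s j)
      = ∑ m, leafMetric G σ s l m * riemannUp (leafMetric G σ) s m k i j := by
    rw [curvForm, h.curv_frame hs]
    simp [leafMetric_apply, mul_comm]
  have h2 (m k i j : Fin 2) : riemannUp (leafMetric G σ) s m k i j = ∑ l, (leafMetric G σ s)⁻¹ m l
      * curvForm G (σ s) (leafFrame σ s l) (leafFrame σ s k) (leafFrame σ s i)
        (leafFrame σ s j) := by
    have h3 := Matrix.nonsing_inv_mul _ (isUnit_iff_ne_zero.2 (h.metric_det hs))
    have h4 (n : Fin 2) : ∑ l, (leafMetric G σ s)⁻¹ m l * leafMetric G σ s l n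
        = if m = n then 1 else 0 := by
      rw [← Matrix.mul_apply, h3, Matrix.one_apply]
    simp only [h1, Finset.mul_sum, ← mul_assoc]
    rw [Finset.sum_comm]
    simp [← Finset.sum_mul, h4]
  obtain ⟨q00, q01, q10, q11⟩ := inv_pairGram_apply (B := metricMap G (σ s)) (leafFrame σ s)
  have hd := det_pairGram (h.killing hs).levi.symm (leafFrame σ s)
  have hQ := h.metric_det hs
  rw [pairGram_leafFrame] at q00 q01 q10 q11 hd
  have a1 := hT.antisymm (leafFrame σ s 1) (leafFrame σ s 0)
  have a2 := fun u v => hT.antisymm_right u v (leafFrame σ s 1) (leafFrame σ s 0)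
  simp only [scalarCurv, ricci, h2, Fin.sum_univ_two, q00, q01, q10, q11, hT.self_left,
    hT.self_right, a1, a2, (h.killing hs).levi.symm (leafFrame σ s 1) (leafFrame σ s 0)]
  generalize (leafMetric G σ s).det = d at *
  field_simp
  rw [hd]
  ring

end Leaf

/-! ### Curvature components as first-order expressions in `g` and `h` -/

section LeafCurvature

variable {G : Coord 4 → Matrix (Fin 4) (Fin 4) ℝ} {ξ : Fin 2 → Coord 4 → Coord 4}
  {U : Set (Coord 4)} {V : Set (Coord 2)} {σ : Coord 2 → Coord 4} {s : Coord 2}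

theorem IsKillingLeaf.dh_eq (h : IsKillingLeaf G ξ U V σ) (hs : s ∈ V) (i k l : Fin 2) :
    (jet (leafMetric G σ) (leafGram G ξ σ) s).dh i k l = 2 * metricMap G (σ s)
      (covAlong (christoffelMap G) id (ξ k) (leafFrame σ s i) (σ s)) (ξ l (σ s)) := by
  have h1 : HasFDerivAt (fun r => metricMap G (σ r) (ξ k (σ r)) (ξ l (σ r)))
      ((fderiv ℝ (fun z => metricMap G z (ξ k z) (ξ l z)) (σ s)).comp (fderiv ℝ σ s)) s :=
    HasFDerivAt.comp s (g := fun z => metricMap G z (ξ k z) (ξ l z))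
      ((h.smooth_gram hs k l).differentiableAt (by simp)).hasFDerivAt
      (h.differentiableAt_leaf hs).hasFDerivAt
  simp only [jet, Matrix.of_apply, pd, leafGram, killingGram, ← metricMap_apply]
  rw [h1.fderiv]
  exact (h.killing hs).fderiv_gram k l _

theorem IsKillingLeaf.dh_symm (h : IsKillingLeaf G ξ U V σ) (hs : s ∈ V) (i : Fin 2) :
    (jet (leafMetric G σ) (leafGram G ξ σ) s).dh i 1 0
      = (jet (leafMetric G σ) (leafGram G ξ σ) s).dh i 0 1 := by
  have h1 : (fun r => leafGram G ξ σ r 1 0) =ᶠ[nhds s] fun r => leafGram G ξ σ r 0 1 := by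
    refine Filter.eventually_of_mem (h.leaf.isOpen.mem_nhds hs) fun r hr => ?_
    simp only [leafGram, killingGram, Matrix.of_apply, ← metricMap_apply]
    exact (h.killing hr).levi.symm _ _
  simp only [jet, Matrix.of_apply, pd]
  rw [h1.fderiv_eq]

/-- The expression is symmetric in `m, k` because the fields commute, and antisymmetric in `m, l` by
the Killing equation; such a tensor is zero. -/
theorem IsKillingLeaf.cov_killing_killing (h : IsKillingLeaf G ξ U V σ) (hs : s ∈ V)
    (m k l : Fin 2) : metricMap G (σ s)
      (covAlong (christoffelMap G) id (ξ k) (ξ m (σ s)) (σ s)) (ξ l (σ s)) = 0 := by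
  have h1 (m k l : Fin 2) := (h.killing hs).killing k (ξ m (σ s)) (ξ l (σ s))
  have h2 (m k : Fin 2) := (h.killing hs).commute k m
  have e1 := h1 m k l
  have e2 := h1 k l m
  have e3 := h1 l m k
  rw [h2 k l, h2 m l] at e2
  rw [h2 k m] at e3
  linarith

theorem IsKillingLeaf.cov_killing_frame (h : IsKillingLeaf G ξ U V σ) (hs : s ∈ V)
    (m k i : Fin 2) : metricMap G (σ s)
      (covAlong (christoffelMap G) id (ξ k) (ξ m (σ s)) (σ s)) (leafFrame σ s i)
      = -(1 / 2) * (jet (leafMetric G σ) (leafGram G ξ σ) s).dh i k m := by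
  rw [h.dh_eq hs]
  linarith [(h.killing hs).killing k (ξ m (σ s)) (leafFrame σ s i)]

theorem IsKillingLeaf.curvForm_killing (h : IsKillingLeaf G ξ U V σ) (hs : s ∈ V)
    (u v : Coord 4) : curvForm G (σ s) (ξ 0 (σ s)) (ξ 1 (σ s)) u v =
      metricMap G (σ s) (covAlong (christoffelMap G) id (ξ 1) u (σ s))
        (covAlong (christoffelMap G) id (ξ 0) v (σ s))
      - metricMap G (σ s) (covAlong (christoffelMap G) id (ξ 1) v (σ s))
        (covAlong (christoffelMap G) id (ξ 0) u (σ s)) := by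
  have h1 : ∀ᶠ z in nhds (σ s), IsCommutingKillingAt (christoffelMap G) (metricMap G) ξ z :=
    Filter.eventually_of_mem (h.isOpen.mem_nhds (h.leaf.mapsTo hs))
      fun z hz => h.pair.isCommutingKillingAt h.isOpen hz
  rw [curvForm, (h.killing hs).levi.symm, IsCommutingKillingAt.metric_curv h1]

/-- The vectors `∇_{ξ_m} ξ_k` are tangent to the leaf with covariant components `-∂_i h_{km} / 2`,
so the curvature is a contraction of products of `dh` with the inverse of `g`. The field equations
are not needed. -/
theorem IsKillingLeaf.curvForm_orbit (h : IsKillingLeaf G ξ U V σ) (hs : s ∈ V) :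
    curvForm G (σ s) (ξ 0 (σ s)) (ξ 1 (σ s)) (ξ 0 (σ s)) (ξ 1 (σ s))
      / (leafGram G ξ σ s).det
      = -(jet (leafMetric G σ) (leafGram G ξ σ) s).Cchi / 4 := by
  have ho := h.isOrthogonalPair hs
  have hx : (leafGram G ξ σ s).det ≠ 0 := h.pair.transversal _ (h.leaf.mapsTo hs)
  obtain ⟨q00, q01, q10, q11⟩ := inv_pairGram_apply (B := metricMap G (σ s)) (leafFrame σ s)
  rw [pairGram_leafFrame] at q00 q01 q10 q11
  rw [h.curvForm_killing hs, ho.metric_eq, ho.metric_eq]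
  simp only [h.cov_killing_killing hs, h.cov_killing_frame hs, pairGram_leafFrame, OneJet.Cchi,
    OneJet.chi, OneJet.x, Matrix.of_apply]
  have e1 : (jet (leafMetric G σ) (leafGram G ξ σ) s).g = leafMetric G σ s := rfl
  have e2 : (jet (leafMetric G σ) (leafGram G ξ σ) s).h = leafGram G ξ σ s := rfl
  rw [e1, e2]
  simp only [Fin.sum_univ_two, h.dh_symm hs, q01, q10, ho.symm (leafFrame σ s 1) (leafFrame σ s 0)]
  field_simp
  ring

/-- The determinant of the Cosgrove form. -/
theorem OneJet.det_gamma (j : OneJet) (hx : j.x ≠ 0) (hs : j.h 1 0 = j.h 0 1)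
    (hd : ∀ i, j.dh i 1 0 = j.dh i 0 1) : j.gamma.det =
    (j.h 1 1 * (j.dh 0 0 1 * j.dh 1 0 0 - j.dh 1 0 1 * j.dh 0 0 0)
      - j.h 0 1 * (j.dh 0 1 1 * j.dh 1 0 0 - j.dh 1 1 1 * j.dh 0 0 0)
      + j.h 0 0 * (j.dh 0 1 1 * j.dh 1 0 1 - j.dh 1 1 1 * j.dh 0 0 1)) ^ 2 / (4 * j.x ^ 3) := by
  have hx' : j.x = j.h 0 0 * j.h 1 1 - j.h 0 1 ^ 2 := by
    rw [OneJet.x, Matrix.det_fin_two, hs]; ring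
  simp only [Matrix.det_fin_two, OneJet.gamma, OneJet.chi, OneJet.rho, Matrix.sub_apply,
    Matrix.smul_apply, Matrix.of_apply, OneJet.dx, smul_eq_mul, hd, hs]
  generalize j.x = x at *
  -- The expression squared on the right is, up to sign, the `3 × 3` determinant of the components
  -- of `h`, `∂₁h`, `∂₂h`.
  field_simp
  rw [hx']
  ring

/-- The vectors `∇_{e_i} ξ_k` lie in the Killing plane with covariant components `∂_i h_{kl} / 2`.
Contracting with `h⁻¹` gives, up to sign and a factor `4 det h`, the determinant whose square occurs
in `det γ`. -/
theorem IsKillingLeaf.Qgamma_eq (h : IsKillingLeaf G ξ U V σ) (hs : s ∈ V) :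
    (jet (leafMetric G σ) (leafGram G ξ σ) s).Qgamma =
      4 * curvForm G (σ s) (ξ 0 (σ s)) (ξ 1 (σ s)) (leafFrame σ s 0) (leafFrame σ s 1) ^ 2
        / ((leafGram G ξ σ s).det * (leafMetric G σ s).det) := by
  have ho := h.isOrthogonalPair hs
  have hx : (leafGram G ξ σ s).det ≠ 0 := h.pair.transversal _ (h.leaf.mapsTo hs)
  have hy : (leafMetric G σ s).det ≠ 0 := h.metric_det hs
  have h01 : leafGram G ξ σ s 1 0 = leafGram G ξ σ s 0 1 := by
    simp only [leafGram, killingGram, Matrix.of_apply, ← metricMap_apply]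
    exact (h.killing hs).levi.symm _ _
  have hP : pairGram (metricMap G (σ s)) (fun k => ξ k (σ s)) = leafGram G ξ σ s :=
    pairGram_killing _
  have hγ := OneJet.det_gamma (jet (leafMetric G σ) (leafGram G ξ σ) s) hx h01 (h.dh_symm hs)
  have hc (i k l : Fin 2) : metricMap G (σ s)
      (covAlong (christoffelMap G) id (ξ k) (leafFrame σ s i) (σ s)) (ξ l (σ s))
      = (1 / 2) * (jet (leafMetric G σ) (leafGram G ξ σ) s).dh i k l := by
    rw [h.dh_eq hs]; ring
  have e0 : (jet (leafMetric G σ) (leafGram G ξ σ) s).g = leafMetric G σ s := rfl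
  have e1 : (jet (leafMetric G σ) (leafGram G ξ σ) s).h = leafGram G ξ σ s := rfl
  have e2 : (jet (leafMetric G σ) (leafGram G ξ σ) s).x = (leafGram G ξ σ s).det := rfl
  rw [OneJet.Qgamma, hγ, h.curvForm_killing hs, ho.metric_eq, ho.metric_eq]
  simp only [hc, (h.cov_orth hs _ _ _).1, hP, e0, e1, e2]
  rw [Matrix.inv_def, Matrix.adjugate_fin_two]
  simp only [Fin.sum_univ_two, h.dh_symm hs, Ring.inverse_eq_inv', Matrix.smul_apply,
    Matrix.of_apply, Matrix.cons_val_zero, Matrix.cons_val_one, Matrix.cons_val', smul_eq_mul,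
    Matrix.cons_val_fin_one, h01]
  generalize (leafGram G ξ σ s).det = x at *
  generalize (leafMetric G σ s).det = y at *
  field_simp
  ring

end LeafCurvature

/-! ### Invariance under diffeomorphisms and changes of the Killing basis -/

section Invariance

variable {g h : Coord 2 → Matrix (Fin 2) (Fin 2) ℝ} {φ : Coord 2 → Coord 2}
  {a : Matrix (Fin 2) (Fin 2) ℝ} {t : Coord 2}

/-- The Jacobian matrix of `φ`. -/
def jacobian (φ : Coord 2 → Coord 2) (t : Coord 2) : Matrix (Fin 2) (Fin 2) ℝ :=
  Matrix.of fun p i => fderiv ℝ φ t (coordVec i) p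

theorem pullback_eq (φ : Coord 2 → Coord 2) (g : Coord 2 → Matrix (Fin 2) (Fin 2) ℝ)
    (t : Coord 2) : pullback φ g t = (jacobian φ t)ᵀ * g (φ t) * jacobian φ t := by
  ext i j
  simp [pullback, ip, jacobian, Matrix.mul_apply, Fin.sum_univ_two]
  ring

theorem jacobian_det_ne_zero (hφ : Function.Bijective (fderiv ℝ φ t)) :
    (jacobian φ t).det ≠ 0 := by
  have h1 : LinearIndependent ℝ (jacobian φ t).col := by
    have h2 := ((EuclideanSpace.basisFun (Fin 2) ℝ).toBasis.linearIndependent.map'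
      (fderiv ℝ φ t).toLinearMap (LinearMap.ker_eq_bot.2 hφ.1)).map'
        (WithLp.linearEquiv 2 ℝ (Fin 2 → ℝ)).toLinearMap (LinearEquiv.ker _)
    have h3 : (WithLp.linearEquiv 2 ℝ (Fin 2 → ℝ)).toLinearMap ∘ (fderiv ℝ φ t).toLinearMap ∘
        (EuclideanSpace.basisFun (Fin 2) ℝ).toBasis = (jacobian φ t).col := by
      funext i p; simp [jacobian, coordVec, Matrix.col]
    rwa [h3] at h2
  rw [Matrix.linearIndependent_cols_iff_isUnit, Matrix.isUnit_iff_isUnit_det] at h1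
  exact h1.ne_zero

/-- Transformation of the derivatives of `h` under local diffeomorphisms and changes of basis. -/
theorem pd_congruence (hh : ∀ i j, DifferentiableAt ℝ (fun s => h s i j) (φ t))
    (hφ : DifferentiableAt ℝ φ t) (i k l : Fin 2) :
    pd i (fun s => (aᵀ * h (φ s) * a) k l) t = ∑ p, jacobian φ t p i *
      ∑ m, ∑ n, a m k * pd p (fun s => h s m n) (φ t) * a n l := by
  have h1 (m n : Fin 2) : HasFDerivAt (fun s => h (φ s) m n)
      ((fderiv ℝ (fun s => h s m n) (φ t)).comp (fderiv ℝ φ t)) t :=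
    HasFDerivAt.comp t (g := fun s => h s m n) (hh m n).hasFDerivAt hφ.hasFDerivAt
  have h2 : HasFDerivAt (fun s => (aᵀ * h (φ s) * a) k l) (∑ m, ∑ n, (a m k * a n l) •
      (fderiv ℝ (fun s => h s m n) (φ t)).comp (fderiv ℝ φ t)) t := by
    have h3 : (fun s => (aᵀ * h (φ s) * a) k l)
        = fun s => ∑ m, ∑ n, (a m k * a n l) * h (φ s) m n := by
      funext s
      simp only [Matrix.mul_apply, Fin.sum_univ_two, Matrix.transpose_apply]
      ring
    rw [h3]
    exact HasFDerivAt.fun_sum fun m _ => HasFDerivAt.fun_sum fun n _ => (h1 m n).const_mul _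
  have h4 (m n : Fin 2) : fderiv ℝ (fun s => h s m n) (φ t) (fderiv ℝ φ t (coordVec i))
      = ∑ p, jacobian φ t p i * pd p (fun s => h s m n) (φ t) := by
    conv_lhs => rw [← sum_smul_coordVec (fderiv ℝ φ t (coordVec i))]
    simp [jacobian, pd]
  rw [pd, h2.fderiv]
  simp only [add_apply, smul_apply, ContinuousLinearMap.comp_apply, h4, smul_eq_mul,
    Fin.sum_univ_two]
  ring

/-- Action on 1-jets of a change `J` of coordinates and a change `a` of the Killing basis; only
the components on which the first-order invariants depend are recorded. -/
structure IsTransformed (j j' : OneJet) (J a : Matrix (Fin 2) (Fin 2) ℝ) : Prop where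
  g : j'.g = Jᵀ * j.g * J
  h : j'.h = aᵀ * j.h * a
  dh : ∀ i, j'.dh i = ∑ p, J p i • (aᵀ * j.dh p * a)

variable {j j' : OneJet} {J : Matrix (Fin 2) (Fin 2) ℝ}

theorem isTransformed_jet (hh : ∀ i j, DifferentiableAt ℝ (fun s => h s i j) (φ t))
    (hφ : DifferentiableAt ℝ φ t) : IsTransformed (jet g h (φ t))
      (jet (pullback φ g) (fun s => aᵀ * h (φ s) * a) t) (jacobian φ t) a := by
  refine ⟨pullback_eq φ g t, rfl, fun i => ?_⟩
  ext k l
  simp only [jet, Matrix.of_apply]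
  rw [pd_congruence hh hφ]
  simp [Matrix.mul_apply, Fin.sum_univ_two]
  ring

theorem IsTransformed.x (H : IsTransformed j j' J a) : j'.x = a.det ^ 2 * j.x := by
  rw [OneJet.x, H.h, Matrix.det_mul, Matrix.det_mul, Matrix.det_transpose, OneJet.x]
  ring

theorem IsTransformed.dx (H : IsTransformed j j' J a) (i : Fin 2) :
    j'.dx i = a.det ^ 2 * ∑ p, J p i * j.dx p := by
  simp only [OneJet.dx, H.h, H.dh, Matrix.det_fin_two, Fin.sum_univ_two, Matrix.add_apply,
    Matrix.smul_apply, Matrix.mul_apply, Matrix.transpose_apply, smul_eq_mul]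
  ring

theorem IsTransformed.rho (H : IsTransformed j j' J a) (ha : a.det ≠ 0) (hx : j.x ≠ 0) :
    j'.rho = Jᵀ * j.rho * J := by
  ext i k
  simp only [OneJet.rho, H.dx, H.x, Matrix.mul_apply, Matrix.transpose_apply, Matrix.of_apply,
    Fin.sum_univ_two]
  field_simp

theorem IsTransformed.chi (H : IsTransformed j j' J a) (ha : a.det ≠ 0) (hx : j.x ≠ 0) :
    j'.chi = Jᵀ * j.chi * J := by
  -- The polarized determinant of `2 × 2` matrices is multiplied by `det a ^ 2` under congruence,
  -- exactly as `x` is.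
  have key (u v : Matrix (Fin 2) (Fin 2) ℝ) :
      (aᵀ * u * a) 0 0 * (aᵀ * v * a) 1 1 - (aᵀ * v * a) 0 1 * (aᵀ * u * a) 1 0
      + ((aᵀ * v * a) 0 0 * (aᵀ * u * a) 1 1 - (aᵀ * u * a) 0 1 * (aᵀ * v * a) 1 0)
      = a.det ^ 2 * (u 0 0 * v 1 1 - v 0 1 * u 1 0 + (v 0 0 * u 1 1 - u 0 1 * v 1 0)) := by
    simp only [Matrix.det_fin_two, Matrix.mul_apply, Fin.sum_univ_two, Matrix.transpose_apply]
    ring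
  ext i k
  have k00 := key (j.dh 0) (j.dh 0)
  have k01 := key (j.dh 0) (j.dh 1)
  have k11 := key (j.dh 1) (j.dh 1)
  have hR (M : Matrix (Fin 2) (Fin 2) ℝ) : (Jᵀ * M * J) i k = J 0 i * M 0 0 * J 0 k
      + J 0 i * M 0 1 * J 1 k + J 1 i * M 1 0 * J 0 k + J 1 i * M 1 1 * J 1 k := by
    simp only [Matrix.mul_apply, Fin.sum_univ_two, Matrix.transpose_apply]
    ring
  rw [hR]
  simp only [OneJet.chi, H.dh, H.x, Fin.sum_univ_two, Matrix.add_apply, Matrix.smul_apply,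
    smul_eq_mul, Matrix.of_apply]
  generalize aᵀ * j.dh 0 * a = u at *
  generalize aᵀ * j.dh 1 * a = v at *
  field_simp
  linear_combination J 0 i * J 0 k * k00 + (J 0 i * J 1 k + J 1 i * J 0 k) * k01
    + J 1 i * J 1 k * k11

/-- As a trace of `g⁻¹ χ`, the quantity is unchanged because `g⁻¹ χ` is conjugated by `J`. -/
theorem IsTransformed.Cchi (H : IsTransformed j j' J a) (ha : a.det ≠ 0) (hx : j.x ≠ 0)
    (hJ : J.det ≠ 0) (hs : j.g.IsSymm) : j'.Cchi = j.Cchi := by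
  have htr (j : OneJet) (hs : j.g.IsSymm) : j.Cchi = (j.g⁻¹ * j.chi).trace := by
    simp only [OneJet.Cchi, Matrix.trace, Matrix.diag, Matrix.mul_apply]
    refine Finset.sum_congr rfl fun i _ => Finset.sum_congr rfl fun k _ => ?_
    congr 1
    simp only [OneJet.chi, Matrix.of_apply]
    ring
  have hs' : j'.g.IsSymm := by
    rw [H.g, Matrix.IsSymm, Matrix.transpose_mul, Matrix.transpose_mul, Matrix.transpose_transpose,
      hs.eq, Matrix.mul_assoc]
  have hu := isUnit_iff_ne_zero.2 hJ
  rw [htr j hs, htr j' hs', H.chi ha hx, H.g, Matrix.mul_inv_rev, Matrix.mul_inv_rev,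
    Matrix.mul_assoc Jᵀ, Matrix.mul_assoc J⁻¹, Matrix.mul_assoc (j.g)⁻¹,
    Matrix.nonsing_inv_mul_cancel_left _ _ (by rwa [Matrix.det_transpose]), Matrix.trace_mul_comm,
    Matrix.mul_assoc, Matrix.mul_assoc, Matrix.mul_nonsing_inv _ hu, Matrix.mul_one]

theorem IsTransformed.Qgamma (H : IsTransformed j j' J a) (ha : a.det ≠ 0) (hx : j.x ≠ 0)
    (hJ : J.det ≠ 0) : j'.Qgamma = j.Qgamma := by
  have hγ : j'.gamma = Jᵀ * j.gamma * J := by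
    rw [OneJet.gamma, OneJet.gamma, H.rho ha hx, H.chi ha hx]
    simp [Matrix.mul_sub, Matrix.sub_mul]
  rw [OneJet.Qgamma, OneJet.Qgamma, hγ, H.g]
  simp only [Matrix.det_mul, Matrix.det_transpose]
  rw [mul_right_comm, mul_right_comm J.det j.g.det, mul_div_mul_left _ _ (mul_ne_zero hJ hJ)]

/-- A function of `C_χ` and `Q_γ` is a first-order invariant. -/
theorem isFirstOrderInvariant_comp (f : ℝ → ℝ → ℝ) :
    IsFirstOrderInvariant fun j => f j.Cchi j.Qgamma := by
  intro W V g h φ a hW hV hg hh hgh hφ hm hb t ht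
  have hd : DifferentiableAt ℝ φ t :=
    (hφ.contDiffAt (hV.mem_nhds ht)).differentiableAt (by simp)
  have H := isTransformed_jet (g := g) (a := (a : Matrix (Fin 2) (Fin 2) ℝ)) (fun i j =>
    ((hh i j).contDiffAt (hW.mem_nhds (hm ht))).differentiableAt (by simp)) hd
  have ha : (a : Matrix (Fin 2) (Fin 2) ℝ).det ≠ 0 := (Matrix.GeneralLinearGroup.det a).ne_zero
  obtain ⟨hs, -, -, hx⟩ := hgh _ (hm ht)
  have hJ := jacobian_det_ne_zero (hb t ht)
  simp only
  rw [H.Cchi ha hx hJ hs, H.Qgamma ha hx hJ]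

end Invariance

/-! ### The formulas for scalar curvature and `Ψ₂` -/

section Main

variable {G : Coord 4 → Matrix (Fin 4) (Fin 4) ℝ} {ξ : Fin 2 → Coord 4 → Coord 4}
  {U : Set (Coord 4)} {V : Set (Coord 2)} {σ : Coord 2 → Coord 4} {s : Coord 2}

theorem IsKillingLeaf.vacuum (h : IsKillingLeaf G ξ U V σ) (hs : s ∈ V) {Λ : ℝ}
    (hv : ∀ a b, ricci G (σ s) a b - (1 / 2) * scalarCurv G (σ s) * G (σ s) a b
      + Λ * G (σ s) a b = 0) :
    scalarCurv G (σ s) = 4 * Λ ∧ ∀ v w, ricForm G (σ s) v w = Λ * metricMap G (σ s) v w :=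
  ricForm_of_vacuum (h.smooth_components hs) (h.pair.metric_nondeg _ (h.leaf.mapsTo hs))
    (h.pair.metric_symm _ (h.leaf.mapsTo hs)) hv

/-- The field equations carry the first-order expression for the sectional curvature of the Killing
plane over to the leaf. -/
theorem IsKillingLeaf.curvForm_leaf_of_vacuum (h : IsKillingLeaf G ξ U V σ) (hs : s ∈ V) {Λ : ℝ}
    (hv : ∀ a b, ricci G (σ s) a b - (1 / 2) * scalarCurv G (σ s) * G (σ s) a b
      + Λ * G (σ s) a b = 0) :
    curvForm G (σ s) (leafFrame σ s 0) (leafFrame σ s 1) (leafFrame σ s 0) (leafFrame σ s 1)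
      / (leafMetric G σ s).det = -(jet (leafMetric G σ) (leafGram G ξ σ) s).Cchi / 4 := by
  have ho := h.isOrthogonalPair hs
  have h1 := (h.isCurvatureForm hs).einstein_planes ho (c := Λ) fun v w => by
    rw [← ricForm_eq ho, (h.vacuum hs hv).2]
  rw [pairGram_killing, pairGram_leafFrame] at h1
  rw [← h1, ← h.curvForm_orbit hs]
  rfl

/-- The leaves of a vacuum metric have the scalar curvature `-C_χ / 2`. -/
theorem IsKillingLeaf.scalarCurv_of_vacuum (h : IsKillingLeaf G ξ U V σ) (hs : s ∈ V) {Λ : ℝ}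
    (hv : ∀ a b, ricci G (σ s) a b - (1 / 2) * scalarCurv G (σ s) * G (σ s) a b
      + Λ * G (σ s) a b = 0) : scalarCurv (leafMetric G σ) s
      = -(jet (leafMetric G σ) (leafGram G ξ σ) s).Cchi / 2 := by
  rw [h.scalarCurv_eq hs, mul_div_assoc, h.curvForm_leaf_of_vacuum hs hv]
  ring

theorem IsKillingLeaf.det_mul_neg (h : IsKillingLeaf G ξ U V σ) (hs : s ∈ V)
    (hd : (G (σ s)).det < 0) : (leafGram G ξ σ s).det * (leafMetric G σ s).det < 0 := by
  obtain ⟨d, hd0, hd1⟩ := h.exists_det hs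
  rw [hd1]
  exact mul_neg_of_pos_of_neg (by positivity) hd

theorem IsKillingLeaf.Qgamma_nonpos (h : IsKillingLeaf G ξ U V σ) (hs : s ∈ V)
    (hd : (G (σ s)).det < 0) : (jet (leafMetric G σ) (leafGram G ξ σ) s).Qgamma ≤ 0 := by
  rw [h.Qgamma_eq hs]
  exact div_nonpos_of_nonneg_of_nonpos (by positivity) (h.det_mul_neg hs hd).le

variable {k l : Coord 4} {m : Fin 4 → ℂ}

theorem exists_of_mem_killingPlane {y : Coord 4} (hk : k ∈ killingPlane ξ y) :
    ∃ α : Fin 2 → ℝ, k = ∑ i, α i • ξ i y := by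
  obtain ⟨α, hα⟩ := (Submodule.mem_span_range_iff_exists_fun ℝ).1 hk
  exact ⟨α, hα.symm⟩

theorem sum_mem_killingPlane (y : Coord 4) (α : Fin 2 → ℝ) :
    ∑ i, α i • ξ i y ∈ killingPlane ξ y :=
  (Submodule.mem_span_range_iff_exists_fun ℝ).2 ⟨α, rfl⟩

theorem IsKillingLeaf.exists_of_mem_orthPlane (h : IsKillingLeaf G ξ U V σ) (hs : s ∈ V)
    (hk : k ∈ orthPlane G ξ (σ s)) : ∃ α : Fin 2 → ℝ, k = ∑ i, α i • leafFrame σ s i :=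
  (h.isOrthogonalPair hs).exists_of_orth fun i => by rw [metricMap_apply]; exact hk i

theorem IsKillingLeaf.sum_mem_orthPlane (h : IsKillingLeaf G ξ U V σ) (hs : s ∈ V)
    (α : Fin 2 → ℝ) : ∑ i, α i • leafFrame σ s i ∈ orthPlane G ξ (σ s) := by
  intro i
  rw [← metricMap_apply]
  simp [h.orth hs]

theorem IsKillingLeaf.psi2_im_sq (h : IsKillingLeaf G ξ U V σ) (hs : s ∈ V)
    (ht : IsAdaptedTetrad G ξ (σ s) k l m) : (psi2 G (σ s) k l m).im ^ 2
      = -(jet (leafMetric G σ) (leafGram G ξ σ) s).Qgamma / 16 := by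
  have ho := h.isOrthogonalPair hs
  have hT := h.isCurvatureForm hs
  obtain ⟨h1, h2⟩ := ht
  obtain ⟨ε, h3⟩ := (isNullTetrad_iff ho.symm k l m).1 h1
  rw [psi2_im_eq (h.smooth_components hs) (h.pair.metric_nondeg _ (h.leaf.mapsTo hs)) hT ho.symm h3,
    h.Qgamma_eq hs]
  have hx := ho.left
  have hy := ho.right
  rcases h2 with ⟨hk, hl, ha, hb⟩ | ⟨hk, hl, ha, hb⟩
  · obtain ⟨α, hα⟩ := exists_of_mem_killingPlane hk
    obtain ⟨β, hβ⟩ := exists_of_mem_killingPlane hl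
    obtain ⟨γ, hγ⟩ := h.exists_of_mem_orthPlane hs ha
    obtain ⟨δ, hδ⟩ := h.exists_of_mem_orthPlane hs hb
    rw [(hT.tetrad ho h3 hα hβ hγ hδ).1]
    rw [pairGram_killing] at hx ⊢
    rw [pairGram_leafFrame] at hy ⊢
    change (leafGram G ξ σ s).det ≠ 0 at hx
    change _ / (4 * ((leafGram G ξ σ s).det * _)) = _
    field_simp
    ring
  · obtain ⟨α, hα⟩ := h.exists_of_mem_orthPlane hs hk
    obtain ⟨β, hβ⟩ := h.exists_of_mem_orthPlane hs hl
    obtain ⟨γ, hγ⟩ := exists_of_mem_killingPlane ha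
    obtain ⟨δ, hδ⟩ := exists_of_mem_killingPlane hb
    -- With the planes interchanged, the mixed component appears with the leaf frame first; pair
    -- symmetry brings it back.
    rw [(hT.tetrad ho.swap h3 hα hβ hγ hδ).1, hT.pair_symm (leafFrame σ s 0)]
    rw [pairGram_killing] at hx ⊢
    rw [pairGram_leafFrame] at hy ⊢
    change (leafGram G ξ σ s).det ≠ 0 at hx
    change _ / (4 * (_ * (leafGram G ξ σ s).det)) = _
    field_simp
    ring

/-- The imaginary part of `Ψ₂`. -/
theorem IsKillingLeaf.abs_psi2_im (h : IsKillingLeaf G ξ U V σ) (hs : s ∈ V)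
    (ht : IsAdaptedTetrad G ξ (σ s) k l m) : |(psi2 G (σ s) k l m).im|
      = Real.sqrt (-(jet (leafMetric G σ) (leafGram G ξ σ) s).Qgamma) / 4 := by
  have h1 := h.psi2_im_sq hs ht
  have h2 : -(jet (leafMetric G σ) (leafGram G ξ σ) s).Qgamma
      = (4 * (psi2 G (σ s) k l m).im) ^ 2 := by linarith
  rw [h2, Real.sqrt_sq_eq_abs, abs_mul, abs_of_pos (by norm_num : (0 : ℝ) < 4)]
  ring

/-- The real part of `Ψ₂` for a vacuum metric. -/
theorem IsKillingLeaf.psi2_re_of_vacuum (h : IsKillingLeaf G ξ U V σ) (hs : s ∈ V)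
    (ht : IsAdaptedTetrad G ξ (σ s) k l m) {Λ : ℝ}
    (hv : ∀ a b, ricci G (σ s) a b - (1 / 2) * scalarCurv G (σ s) * G (σ s) a b
      + Λ * G (σ s) a b = 0) : (psi2 G (σ s) k l m).re
      = (jet (leafMetric G σ) (leafGram G ξ σ) s).Cchi / 8 + Λ / 6 := by
  have ho := h.isOrthogonalPair hs
  have hT := h.isCurvatureForm hs
  obtain ⟨h1, h2⟩ := ht
  obtain ⟨ε, h3⟩ := (isNullTetrad_iff ho.symm k l m).1 h1
  rw [psi2_re_eq (h.smooth_components hs) (h.pair.metric_nondeg _ (h.leaf.mapsTo hs)) hT ho.symm h3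
    (h.vacuum hs hv).1 (h.vacuum hs hv).2]
  suffices curvForm G (σ s) k l k l
      = (jet (leafMetric G σ) (leafGram G ξ σ) s).Cchi / 4 by rw [this]; ring
  -- If `k, l` span the Killing plane, its curvature formula applies directly; if they are tangent
  -- to the leaf, the equality of sectional curvatures is needed as well.
  rcases h2 with ⟨hk, hl, ha, hb⟩ | ⟨hk, hl, ha, hb⟩
  · obtain ⟨α, hα⟩ := exists_of_mem_killingPlane hk
    obtain ⟨β, hβ⟩ := exists_of_mem_killingPlane hl
    obtain ⟨γ, hγ⟩ := h.exists_of_mem_orthPlane hs ha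
    obtain ⟨δ, hδ⟩ := h.exists_of_mem_orthPlane hs hb
    have h4 := h.curvForm_orbit hs
    rw [(hT.tetrad ho h3 hα hβ hγ hδ).2, pairGram_killing, neg_div]
    change -(_ / (leafGram G ξ σ s).det) = _
    rw [h4]
    ring
  · obtain ⟨α, hα⟩ := h.exists_of_mem_orthPlane hs hk
    obtain ⟨β, hβ⟩ := h.exists_of_mem_orthPlane hs hl
    obtain ⟨γ, hγ⟩ := exists_of_mem_killingPlane ha
    obtain ⟨δ, hδ⟩ := exists_of_mem_killingPlane hb
    rw [(hT.tetrad ho.swap h3 hα hβ hγ hδ).2, pairGram_leafFrame, neg_div,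
      h.curvForm_leaf_of_vacuum hs hv]
    ring

/-- As `det h · det g < 0`, exactly one of the two planes is Lorentzian and carries `k, l`; the
definite plane carries the real and imaginary parts of `m`. -/
theorem IsKillingLeaf.exists_real_tetrad (h : IsKillingLeaf G ξ U V σ) (hs : s ∈ V)
    (hd : (G (σ s)).det < 0) : ∃ (ε : ℝ) (k l u v : Coord 4),
      IsRealTetrad (metricMap G (σ s)) ε k l u v ∧
      ((k ∈ killingPlane ξ (σ s) ∧ l ∈ killingPlane ξ (σ s) ∧
        u ∈ orthPlane G ξ (σ s) ∧ v ∈ orthPlane G ξ (σ s)) ∨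
      (k ∈ orthPlane G ξ (σ s) ∧ l ∈ orthPlane G ξ (σ s) ∧
        u ∈ killingPlane ξ (σ s) ∧ v ∈ killingPlane ξ (σ s))) := by
  have ho := h.isOrthogonalPair hs
  have h1 := h.det_mul_neg hs hd
  rw [← pairGram_leafFrame, leafGram, ← pairGram_killing] at h1
  rcases mul_neg_iff.1 h1 with ⟨h2, h3⟩ | ⟨h2, h3⟩
  · obtain ⟨ε, α, β, γ, δ, ht⟩ := ho.swap.exists_tetrad h3 h2
    exact ⟨ε, _, _, _, _, ht, Or.inr ⟨h.sum_mem_orthPlane hs _, h.sum_mem_orthPlane hs _,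
      sum_mem_killingPlane _ _, sum_mem_killingPlane _ _⟩⟩
  · obtain ⟨ε, α, β, γ, δ, ht⟩ := ho.exists_tetrad h2 h3
    exact ⟨ε, _, _, _, _, ht, Or.inl ⟨sum_mem_killingPlane _ _, sum_mem_killingPlane _ _,
      h.sum_mem_orthPlane hs _, h.sum_mem_orthPlane hs _⟩⟩

theorem neg_mem_killingPlane {y v : Coord 4} (hv : v ∈ killingPlane ξ y) :
    -v ∈ killingPlane ξ y :=
  Submodule.neg_mem _ hv

theorem neg_mem_orthPlane {y v : Coord 4} (hv : v ∈ orthPlane G ξ y) : -v ∈ orthPlane G ξ y := by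
  intro k
  have := hv k
  rw [← metricMap_apply] at this ⊢
  rw [map_neg, this, neg_zero]

/-- There is an adapted null tetrad with `Im Ψ₂ ≥ 0`. -/
theorem IsKillingLeaf.exists_tetrad (h : IsKillingLeaf G ξ U V σ) (hs : s ∈ V)
    (hd : (G (σ s)).det < 0) : ∃ (k l : Coord 4) (m : Fin 4 → ℂ),
      IsAdaptedTetrad G ξ (σ s) k l m ∧ (psi2 G (σ s) k l m).im
        = Real.sqrt (-(jet (leafMetric G σ) (leafGram G ξ σ) s).Qgamma) / 4 := by
  have ho := h.isOrthogonalPair hs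
  have hT := h.isCurvatureForm hs
  obtain ⟨ε, k, l, u, v, ht, hp⟩ := h.exists_real_tetrad hs hd
  let M (w : Coord 4) : Fin 4 → ℂ := fun a => ⟨u a, w a⟩
  have hre (w) : reV (M w) = u := by ext i; simp [reV, M]
  have him (w) : imV (M w) = w := by ext i; simp [imV, M]
  have key (w : Coord 4) (hw : IsRealTetrad (metricMap G (σ s)) ε k l u w) :
      (psi2 G (σ s) k l (M w)).im = curvForm G (σ s) k l u w := by
    rw [psi2_im_eq (h.smooth_components hs) (h.pair.metric_nondeg _ (h.leaf.mapsTo hs)) hT ho.symm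
      (ε := ε) (by rwa [hre, him]), hre, him]
  have had (w : Coord 4) (hw : IsRealTetrad (metricMap G (σ s)) ε k l u w)
      (hwv : w = v ∨ w = -v) : IsAdaptedTetrad G ξ (σ s) k l (M w) := by
    refine ⟨(isNullTetrad_iff ho.symm k l _).2 ⟨ε, by rwa [hre, him]⟩, ?_⟩
    rw [hre, him]
    rcases hwv with rfl | rfl
    · exact hp
    · exact hp.imp (fun a => ⟨a.1, a.2.1, a.2.2.1, neg_mem_orthPlane a.2.2.2⟩)
        fun a => ⟨a.1, a.2.1, a.2.2.1, neg_mem_killingPlane a.2.2.2⟩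
  have h1 := h.abs_psi2_im hs (had v ht (Or.inl rfl))
  rcases abs_choice (psi2 G (σ s) k l (M v)).im with h2 | h2
  · exact ⟨k, l, M v, had v ht (Or.inl rfl), h2 ▸ h1⟩
  -- Replacing `m` by its conjugate changes the sign of `R(k, l, a, b)`.
  · refine ⟨k, l, M (-v), had (-v) ht.neg (Or.inr rfl), ?_⟩
    have h3 := (hT.linear₄ k l u).map_neg v
    rw [← h1, h2, key _ ht.neg, key _ ht, h3]

end Main

end TwoKilling

end

open TwoKilling
theorem mainTheorem5 {M : Type*} [TopologicalSpace M] [ChartedSpace (Coord 4) M]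
    [IsManifold 𝓘(ℝ, Coord 4) ∞ M]
    (gM : ∀ p : M, LinearMap.BilinForm ℝ (TangentSpace 𝓘(ℝ, Coord 4) p))
    (ξ : Fin 2 → ∀ p : M, TangentSpace 𝓘(ℝ, Coord 4) p)
    (hξ : IsOrthogonallyTransitivePair gM ξ) :
    -- the two expressions below are first-order scalar differential invariants
    (∀ Λ : ℝ, IsFirstOrderInvariant fun j => j.Cchi / 8 + Λ / 6) ∧
    (IsFirstOrderInvariant fun j => Real.sqrt (-j.Qgamma) / 4) ∧
    ∀ φ ∈ smoothCharts M, ∀ (V : Set (Coord 2)) (σ : Coord 2 → Coord 4),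
      IsLeaf (metricInChart gM φ) (fieldsInChart ξ φ) φ.target V σ → ∀ t ∈ V,
      -- scalar curvature of the leaves of a vacuum metric
      (∀ Λ : ℝ, IsVacuum gM Λ →
        scalarCurv (leafMetric (metricInChart gM φ) σ) t = -(leafJet gM ξ φ σ t).Cchi / 2) ∧
      (IsLorentz gM →
        -- imaginary part, for every Lorentz metric
        (leafJet gM ξ φ σ t).Qgamma ≤ 0 ∧
        (∃ (k l : Coord 4) (m : Fin 4 → ℂ),
          IsAdaptedTetrad (metricInChart gM φ) (fieldsInChart ξ φ) (σ t) k l m ∧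
          (psi2 (metricInChart gM φ) (σ t) k l m).im
            = Real.sqrt (-(leafJet gM ξ φ σ t).Qgamma) / 4) ∧
        ∀ (k l : Coord 4) (m : Fin 4 → ℂ),
          IsAdaptedTetrad (metricInChart gM φ) (fieldsInChart ξ φ) (σ t) k l m →
          |(psi2 (metricInChart gM φ) (σ t) k l m).im|
            = Real.sqrt (-(leafJet gM ξ φ σ t).Qgamma) / 4 ∧
          -- real part, for vacuum metrics
          ∀ Λ : ℝ, IsVacuum gM Λ →
            (psi2 (metricInChart gM φ) (σ t) k l m).re
              = (leafJet gM ξ φ σ t).Cchi / 8 + Λ / 6) := by 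
  refine ⟨fun Λ => isFirstOrderInvariant_comp fun c _ => c / 8 + Λ / 6,
    isFirstOrderInvariant_comp fun _ q => Real.sqrt (-q) / 4, fun φ hφ V σ hσ t ht => ?_⟩
  have h : IsKillingLeaf (metricInChart gM φ) (fieldsInChart ξ φ) φ.target V σ :=
    ⟨hξ φ hφ, φ.open_target, hσ⟩
  have hy := hσ.mapsTo ht
  refine ⟨fun Λ hv => h.scalarCurv_of_vacuum ht (hv φ hφ _ hy), fun hL =>
    ⟨h.Qgamma_nonpos ht (hL φ hφ _ hy), h.exists_tetrad ht (hL φ hφ _ hy),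
      fun k l m hm => ⟨h.abs_psi2_im ht hm, fun Λ hv =>
        h.psi2_re_of_vacuum ht hm (hv φ hφ _ hy)⟩⟩⟩
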